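/- A literal on the Boolean variables $x_1,\dots,x_n$ is a variable or its negation. A 2-CNF on $n$ variables is a set of clauses, each clause being a set (disjunction) of exactly two literals that correspond to distinct variables; it is satisfiable if some assignment of Boolean values to $x_1,\dots,x_n$ makes at least one literal of every clause true. Consider formal power series in $z$ whose coefficients are formal power series in $w$ over $\mathbb{Q}$, let \[ G(z,w)=\sum_{n\ge 0}(1+w)^{\binom n2}\frac{z^n}{n!},\qquad \widehat{\mathrm{Set}}(z,w)=\sum_{n\ge 0}\frac{1}{(1+w)^{\binom n2}}\frac{z^n}{n!}, \] and let $\odot_z$ denote the exponential Hadamard product \[ \Big(\sum_{n\ge 0}a_n(w)\frac{z^n}{n!}\Big)\odot_z\Big(\sum_{n\ge 0}b_n(w)\frac{z^n}{n!}\Big)=\sum_{n\ge 0}a_n(w)b_n(w)\frac{z^n}{n!}. \] The series $G(z,w)\odot_z\frac{1}{G(z,w)}$ has constant coefficient $1$ in $z$; its square root is the one with constant coefficient $1$ in $z$. Theorem. For all integers $n,m\ge 0$, the number of satisfiable 2-CNFs with $n$ variables and $m$ clauses is \[ 2^n\,n!\,[z^n w^m]\;\widehat{\mathrm{Set}}\big((1+w)^{2(n-1)}z,\,w\big)\,\sqrt{G(z,w)\odot_z\frac{1}{G(z,w)}}.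 \] -/

import Mathlib

open scoped PowerSeries Nat

noncomputable section

namespace TwoSat

/-! ### Formulas -/

/-- A literal on the variables indexed by `Fin n`: `(i, true)` is the variable itself, `(i, false)`
its negation. -/
abbrev Literal (n : ℕ) := Fin n × Bool

/-- A clause, i.e. a disjunction of literals, given by its set of literals. -/
abbrev Clause (n : ℕ) := Finset (Literal n)

/-- A set of clauses. -/
abbrev Formula (n : ℕ) := Finset (Clause n)

/-- A conjunctive normal form: in each clause the literals correspond to distinct variables. -/
def Formula.IsCNF {n : ℕ} (F : Formula n) : Prop :=
  ∀ c ∈ F, ∀ l ∈ c, ∀ l' ∈ c, l.1 = l'.1 → l = l'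

/-- A 2-CNF: a CNF each of whose clauses has exactly two literals. -/
def Formula.IsTwoCNF {n : ℕ} (F : Formula n) : Prop :=
  F.IsCNF ∧ ∀ c ∈ F, c.card = 2

/-- Some assignment of Boolean values makes at least one literal of each clause true. -/
def Formula.Satisfiable {n : ℕ} (F : Formula n) : Prop :=
  ∃ a : Fin n → Bool, ∀ c ∈ F, ∃ l ∈ c, a l.1 = l.2

/-- The number of satisfiable 2-CNFs with `n` variables and `m` clauses. -/
def satCount (n m : ℕ) : ℕ :=
  Nat.card {F : Formula n // F.IsTwoCNF ∧ F.card = m ∧ F.Satisfiable}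

/-! ### Generating functions

A bivariate series in `z, w` is a power series in `z` whose coefficients are power series in `w`. -/

/-- Formal power series in `z, w` over `ℚ`. The outer variable is `z`, the inner one is `w`. -/
abbrev BiSeries := (ℚ⟦X⟧)⟦X⟧

/-- `1 + w` as a unit of the ring of power series in `w`, so that integer powers make sense. -/
def onePlusW : (ℚ⟦X⟧)ˣ where
  val := 1 + PowerSeries.X
  inv := (1 + PowerSeries.X)⁻¹
  val_inv := PowerSeries.mul_inv_cancel _ (by simp)
  inv_val := PowerSeries.inv_mul_cancel _ (by simp)

/-- The exponential generating function `∑ aₙ(w) zⁿ / n!`. -/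
def egf (a : ℕ → ℚ⟦X⟧) : BiSeries :=
  PowerSeries.mk fun n => (1 / (n ! : ℚ)) • a n

/-- The coefficient `aₙ(w)` of a series written as `∑ aₙ(w) zⁿ / n!`. -/
def egfCoeff (f : BiSeries) (n : ℕ) : ℚ⟦X⟧ :=
  (n ! : ℚ) • PowerSeries.coeff n f

/-- The exponential Hadamard product with respect to `z`. -/
def hadamard (f g : BiSeries) : BiSeries :=
  egf fun n => egfCoeff f n * egfCoeff g n

/-- The exponential generating function of graphs, `∑ (1+w)^(n choose 2) zⁿ / n!`. -/
def graphGF : BiSeries :=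
  egf fun n => ((onePlusW ^ (n.choose 2) : (ℚ⟦X⟧)ˣ) : ℚ⟦X⟧)

/-- The graphic generating function of sets, `∑ (1+w)^(-(n choose 2)) zⁿ / n!`. -/
def graphicSet : BiSeries :=
  egf fun n => ((onePlusW ^ (-(n.choose 2 : ℤ)) : (ℚ⟦X⟧)ˣ) : ℚ⟦X⟧)

/-- The multiplicative inverse of a series whose constant coefficient (with respect to `z`)
is `1`. -/
def inverse (f : BiSeries) : BiSeries := PowerSeries.invOfUnit f 1

/-- The square root of a series with constant coefficient `1` (with respect to `z`), namely
`∑ (1/2 choose k) (f - 1)ᵏ`. See `squareRoot_sq`, `constantCoeff_squareRoot`. -/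
def squareRoot (f : BiSeries) : BiSeries :=
  (PowerSeries.binomialSeries ℚ (1 / 2 : ℚ)).subst (f - 1)

/-! ### The objects above are the intended ones -/

theorem mul_inverse (f : BiSeries) (hf : PowerSeries.constantCoeff f = 1) :
    f * inverse f = 1 :=
  PowerSeries.mul_invOfUnit f 1 (by simpa using hf)

theorem constantCoeff_squareRoot (f : BiSeries) (hf : PowerSeries.constantCoeff f = 1) :
    PowerSeries.constantCoeff (squareRoot f) = 1 := by
  have hs : PowerSeries.HasSubst (f - 1) :=
    PowerSeries.HasSubst.of_constantCoeff_zero' (by simp [hf])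
  have h0 : PowerSeries.constantCoeff (f - 1) = 0 := by simp [hf]
  rw [← PowerSeries.coeff_zero_eq_constantCoeff_apply, squareRoot, PowerSeries.coeff_subst' hs,
    finsum_eq_single _ 0]
  · simp
  · intro d hd
    rw [PowerSeries.coeff_zero_eq_constantCoeff_apply, map_pow, h0, zero_pow hd, smul_zero]

theorem squareRoot_sq (f : BiSeries) (hf : PowerSeries.constantCoeff f = 1) :
    squareRoot f ^ 2 = f := by
  have hs : PowerSeries.HasSubst (f - 1) :=
    PowerSeries.HasSubst.of_constantCoeff_zero' (by simp [hf])
  rw [squareRoot, ← PowerSeries.subst_pow hs, pow_two, ← PowerSeries.binomialSeries_add]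
  have h : (1 / 2 + 1 / 2 : ℚ) = ((1 : ℕ) : ℚ) := by norm_num
  rw [h, PowerSeries.binomialSeries_nat, pow_one, PowerSeries.subst_add hs, PowerSeries.subst_X hs]
  have h1 : (1 : ℚ⟦X⟧).subst (f - 1) = (1 : BiSeries) := by
    rw [← PowerSeries.coe_substAlgHom hs, map_one]
  rw [h1]; ring

theorem constantCoeff_graphGF : PowerSeries.constantCoeff graphGF = 1 := by
  rw [← PowerSeries.coeff_zero_eq_constantCoeff_apply]
  simp [graphGF, egf]

theorem constantCoeff_hadamard_graphGF_inverse :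
    PowerSeries.constantCoeff (hadamard graphGF (inverse graphGF)) = 1 := by
  have h := congrArg PowerSeries.constantCoeff (mul_inverse graphGF constantCoeff_graphGF)
  rw [map_mul, constantCoeff_graphGF, one_mul, map_one] at h
  rw [← PowerSeries.coeff_zero_eq_constantCoeff_apply]
  simp [hadamard, egf, egfCoeff, h, constantCoeff_graphGF]

end TwoSat

end

noncomputable section

namespace TwoSat

/-! A clause {a, b} is read as the implications ¬a → b and ¬b → a, so a formula becomes a digraph on
literals, invariant under reversing arcs while negating literals. Every digraph carries `mu`, the
Möbius function of its lattice of predecessor-closed sets. It vanishes when an arc joins two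
different strong components (`mu_eq_zero`) and otherwise is -1 to the number of components
(`mu_union`, `MinClosed.mu_eq`). Summing `mu` over the consistent closed sets of literals gives
`tau`, and summing `tau` over satisfiable formulas, with w marking clauses, gives `tauSum`. The
theorem results from computing `tauSum` in two ways.

First way. For a satisfiable formula every minimal closed set C is consistent. If an arc leaves C
then `tau` is 0 (`tau_eq_zero`); otherwise C and its negation are isolated, and deleting their
variables flips the sign (`tau_eq_neg`). So a nonzero `tau` forces the literals to split into a set
U and its negation with no arcs between, and then `tau` is `mu` of U (`Separating.tau_eq`). Once one
such U exists, the others come from negating U on a set K of variables that no clause links to the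
rest. Hence the binomial square of `tau` is the sum of `mu` over all such U (`sum_tau_mul_tau`). For
fixed U the formulas are exactly the digraphs on U, and there are 2^n choices of U. The
`mu`-weighted digraph series is G ⊙ 1/G (`sigma_eq`), so `tauSum` has as generating function its
square root at 2z (`tauSum_eq`).

Second way. Fix a consistent closed U. Making U false satisfies every admissible clause that touches
its variables. The formula is therefore a digraph on U, some free clauses, and an arbitrary
satisfiable formula on the other variables (`wsum_inClosed`). After division by (1+w)^(n(n-1)) this
is a product with 1/G at 2z. Multiplying by G at 2z isolates the satisfiable formulas (`satSum_eq`),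
and rearranging exponents gives the stated form (`satSum_univ`). -/

/-- A sum over a family of sets vanishes if adding or removing `C` changes the sign. -/
theorem sum_eq_zero_of_symmDiff {β : Type*} [DecidableEq β] (s : Finset (Finset β))
    (C : Finset β) (hC : C.Nonempty) (f : Finset β → ℤ)
    (h : ∀ U ∈ s, f U ≠ 0 → symmDiff U C ∈ s ∧ f (symmDiff U C) = - f U) :
    ∑ U ∈ s, f U = 0 := by
  rw [← Finset.sum_filter_ne_zero]
  refine Finset.sum_involution (fun U _ => symmDiff U C) ?_ ?_ ?_ ?_
  · intro U hU
    rw [Finset.mem_filter] at hU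
    simp [(h U hU.1 hU.2).2]
  · intro U hU _ he
    rw [symmDiff_eq_left] at he
    exact hC.ne_empty he
  · intro U hU
    rw [Finset.mem_filter] at hU ⊢
    obtain ⟨h1, h2⟩ := h U hU.1 hU.2
    exact ⟨h1, by rw [h2]; simpa using hU.2⟩
  · intro U hU
    exact symmDiff_symmDiff_cancel_right _ _

/-! ### Sets of vertices closed under predecessors -/

section Digraph

variable {β : Type*}

/-- `U` is a subset of `V` which no arc inside `V` enters. -/
def InClosed (r : β → β → Prop) (V U : Finset β) : Prop :=
  U ⊆ V ∧ ∀ v ∈ V, ∀ u ∈ U, r v u → v ∈ U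

theorem InClosed.refl (r : β → β → Prop) (V : Finset β) : InClosed r V V :=
  ⟨subset_rfl, fun _ hv _ _ _ => hv⟩

theorem InClosed.empty (r : β → β → Prop) (V : Finset β) : InClosed r V ∅ :=
  ⟨Finset.empty_subset _, fun _ _ _ hu => absurd hu (Finset.notMem_empty _)⟩

theorem InClosed.trans {r : β → β → Prop} {V U W : Finset β} (h : InClosed r V U)
    (h' : InClosed r U W) : InClosed r V W :=
  ⟨h'.1.trans h.1, fun v hv u hu hr => h'.2 v (h.2 v hv u (h'.1 hu) hr) u hu hr⟩

theorem InClosed.mono {r : β → β → Prop} {V U W : Finset β} (h : InClosed r V U)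
    (hW : W ⊆ V) (hU : U ⊆ W) : InClosed r W U :=
  ⟨hU, fun v hv u hu hr => h.2 v (hW hv) u hu hr⟩

open Classical in
/-- The subsets of `V` which are closed under predecessors. -/
def closedSets (r : β → β → Prop) (V : Finset β) : Finset (Finset β) :=
  V.powerset.filter (InClosed r V)

theorem mem_closedSets {r : β → β → Prop} {V U : Finset β} :
    U ∈ closedSets r V ↔ InClosed r V U := by
  simp only [closedSets, Finset.mem_filter, Finset.mem_powerset, and_iff_right_iff_imp]
  exact fun h => h.1

/-- There is no arc between `A` and `B`. -/
def NoArcs (r : β → β → Prop) (A B : Finset β) : Prop :=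
  ∀ a ∈ A, ∀ b ∈ B, ¬ r a b ∧ ¬ r b a

theorem NoArcs.mono {r : β → β → Prop} {A B A' B' : Finset β} (h : NoArcs r A B) (hA : A' ⊆ A)
    (hB : B' ⊆ B) : NoArcs r A' B' :=
  fun a ha b hb => h a (hA ha) b (hB hb)

/-- A minimal nonempty set closed under predecessors. -/
def MinClosed (r : β → β → Prop) (V C : Finset β) : Prop :=
  InClosed r V C ∧ C.Nonempty ∧ ∀ U, InClosed r V U → U ⊆ C → U = ∅ ∨ U = C

theorem MinClosed.mono {r : β → β → Prop} {V C W : Finset β} (h : MinClosed r V C)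
    (hW : InClosed r V W) (hC : C ⊆ W) : MinClosed r W C :=
  ⟨h.1.mono hW.1 hC, h.2.1, fun _ hU hUC => h.2.2 _ (hW.trans hU) hUC⟩

/-- Minimal closed sets are the source strong components; the arguments below peel them off one at a
time instead of using strong connectivity. -/
theorem exists_minClosed {r : β → β → Prop} {V : Finset β} (W : Finset β)
    (hW : InClosed r V W) (hne : W.Nonempty) : ∃ C, C ⊆ W ∧ MinClosed r V C := by
  induction W using Finset.strongInduction with
  | H W ih =>
    by_cases h : MinClosed r V W
    · exact ⟨W, subset_rfl, h⟩
    · simp only [MinClosed, hW, hne, true_and, not_forall, not_or] at h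
      obtain ⟨U, hU, hUW, h1, h2⟩ := h
      obtain ⟨C, hC, hC'⟩ := ih U (hUW.ssubset_of_ne h2) hU (Finset.nonempty_iff_ne_empty.2 h1)
      exact ⟨C, hC.trans hUW, hC'⟩

theorem closedSets_congr {r r' : β → β → Prop} {V : Finset β}
    (h : ∀ a ∈ V, ∀ b ∈ V, (r a b ↔ r' a b)) : closedSets r V = closedSets r' V := by
  ext U
  rw [mem_closedSets, mem_closedSets]
  refine and_congr_right fun hU => forall₂_congr fun v hv => forall₂_congr fun u hu => ?_
  rw [h v hv u (hU hu)]

variable [DecidableEq β]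

theorem InClosed.inter {r : β → β → Prop} {V U W : Finset β} (h : InClosed r V U)
    (h' : InClosed r V W) : InClosed r V (U ∩ W) :=
  ⟨Finset.inter_subset_left.trans h.1, fun v hv u hu hr => by
    rw [Finset.mem_inter] at hu ⊢
    exact ⟨h.2 v hv u hu.1 hr, h'.2 v hv u hu.2 hr⟩⟩

theorem InClosed.inter_of_subset {r : β → β → Prop} {V U W : Finset β} (h : InClosed r V U)
    (hW : W ⊆ V) : InClosed r W (U ∩ W) :=
  ⟨Finset.inter_subset_right, fun v hv u hu hr => by
    rw [Finset.mem_inter] at hu ⊢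
    exact ⟨h.2 v (hW hv) u hu.1 hr, hv⟩⟩

theorem InClosed.union {r : β → β → Prop} {V U W : Finset β} (h : InClosed r V U)
    (h' : InClosed r V W) : InClosed r V (U ∪ W) :=
  ⟨Finset.union_subset h.1 h'.1, fun v hv u hu hr => by
    rw [Finset.mem_union] at hu ⊢
    exact hu.imp (fun hu => h.2 v hv u hu hr) fun hu => h'.2 v hv u hu hr⟩

theorem InClosed.sdiff {r : β → β → Prop} {V U C : Finset β} (h : InClosed r V U)
    (hC : ∀ c ∈ C, ∀ u ∈ U, r c u → u ∈ C) : InClosed r V (U \ C) :=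
  ⟨Finset.sdiff_subset.trans h.1, fun v hv u hu hr => by
    rw [Finset.mem_sdiff] at hu ⊢
    exact ⟨h.2 v hv u hu.1 hr, fun hc => hu.2 (hC v hc u hu.1 hr)⟩⟩

/-- The Möbius function of the lattice of sets closed under predecessors, evaluated at the whole
vertex set. -/
def mu (r : β → β → Prop) (V : Finset β) : ℤ :=
  (if V = ∅ then 1 else 0) -
    ∑ U ∈ ((closedSets r V).erase V).attach, mu r U.1
termination_by V.card
decreasing_by
  have h := U.2
  rw [Finset.mem_erase, mem_closedSets] at h
  exact Finset.card_lt_card (h.2.1.ssubset_of_ne h.1)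

theorem sum_mu (r : β → β → Prop) (V : Finset β) :
    ∑ U ∈ closedSets r V, mu r U = if V = ∅ then 1 else 0 := by
  rw [← Finset.add_sum_erase _ _ (mem_closedSets.2 (InClosed.refl r V)), mu,
    Finset.sum_attach ((closedSets r V).erase V) (fun U => mu r U)]
  ring

theorem mu_empty (r : β → β → Prop) : mu r (∅ : Finset β) = 1 := by
  have h := sum_mu r (∅ : Finset β)
  rwa [show closedSets r (∅ : Finset β) = {∅} from ?_, Finset.sum_singleton, if_pos rfl] at h
  ext U
  rw [mem_closedSets, Finset.mem_singleton]
  refine ⟨fun h => Finset.subset_empty.1 h.1, ?_⟩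
  rintro rfl
  exact InClosed.empty _ _

theorem mu_congr {r r' : β → β → Prop} (V : Finset β)
    (h : ∀ a ∈ V, ∀ b ∈ V, (r a b ↔ r' a b)) : mu r V = mu r' V := by
  induction V using Finset.strongInduction with
  | H V ih =>
    have h1 := sum_mu r V
    have h2 := sum_mu r' V
    rw [← closedSets_congr h] at h2
    rw [← Finset.add_sum_erase _ _ (mem_closedSets.2 (InClosed.refl r V))] at h1 h2
    have : ∑ U ∈ (closedSets r V).erase V, mu r U = ∑ U ∈ (closedSets r V).erase V, mu r' U := by
      refine Finset.sum_congr rfl fun U hU => ?_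
      rw [Finset.mem_erase, mem_closedSets] at hU
      exact ih U (hU.2.1.ssubset_of_ne hU.1) fun a ha b hb => h a (hU.2.1 ha) b (hU.2.1 hb)
    omega

theorem InClosed.union_of_noArcs {r : β → β → Prop} {A B U W : Finset β} (hAB : NoArcs r A B)
    (hU : InClosed r A U) (hW : InClosed r B W) : InClosed r (A ∪ B) (U ∪ W) := by
  refine ⟨Finset.union_subset_union hU.1 hW.1, fun v hv u hu hr => ?_⟩
  rw [Finset.mem_union] at hv hu ⊢
  rcases hu with hu | hu
  · rcases hv with hv | hv
    · exact Or.inl (hU.2 v hv u hu hr)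
    · exact absurd hr (hAB u (hU.1 hu) v hv).2
  · rcases hv with hv | hv
    · exact absurd hr (hAB v hv u (hW.1 hu)).1
    · exact Or.inr (hW.2 v hv u hu hr)

theorem sum_closedSets_union {r : β → β → Prop} {A B : Finset β} (hd : Disjoint A B)
    (hAB : NoArcs r A B) (f : Finset β → ℤ) :
    ∑ U ∈ closedSets r (A ∪ B), f U =
      ∑ p ∈ closedSets r A ×ˢ closedSets r B, f (p.1 ∪ p.2) := by
  symm
  refine Finset.sum_bij' (fun p _ => p.1 ∪ p.2) (fun U _ => (U ∩ A, U ∩ B)) ?_ ?_ ?_ ?_ ?_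
  · intro p hp
    rw [Finset.mem_product, mem_closedSets, mem_closedSets] at hp
    exact mem_closedSets.2 (InClosed.union_of_noArcs hAB hp.1 hp.2)
  · intro U hU
    rw [mem_closedSets] at hU
    rw [Finset.mem_product, mem_closedSets, mem_closedSets]
    exact ⟨hU.inter_of_subset Finset.subset_union_left,
      hU.inter_of_subset Finset.subset_union_right⟩
  · intro p hp
    rw [Finset.mem_product, mem_closedSets, mem_closedSets] at hp
    have h1 : Disjoint p.2 A := (hd.mono_right hp.2.1).symm
    have h2 : Disjoint p.1 B := hd.mono_left hp.1.1
    ext1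
    · simp only [Finset.union_inter_distrib_right, Finset.inter_eq_left.2 hp.1.1,
        Finset.disjoint_iff_inter_eq_empty.1 h1, Finset.union_empty]
    · simp only [Finset.union_inter_distrib_right, Finset.inter_eq_left.2 hp.2.1,
        Finset.disjoint_iff_inter_eq_empty.1 h2, Finset.empty_union]
  · intro U hU
    rw [mem_closedSets] at hU
    simp only [← Finset.inter_union_distrib_left, Finset.inter_eq_left.2 hU.1]
  · intro p _
    rfl

/-- Closed sets of the union are pairs of closed sets, so the product of the two functions satisfies
the recursion that defines `mu` on the union. By induction the recursions can differ only in the top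
term. -/
theorem mu_union {r : β → β → Prop} (A B : Finset β) (hd : Disjoint A B)
    (hAB : NoArcs r A B) : mu r (A ∪ B) = mu r A * mu r B := by
  induction hn : A.card + B.card using Nat.strong_induction_on generalizing A B with
  | h n ih =>
    have h1 := sum_mu r (A ∪ B)
    rw [sum_closedSets_union hd hAB] at h1
    have h2 : ∑ p ∈ closedSets r A ×ˢ closedSets r B, mu r p.1 * mu r p.2 =
        if A ∪ B = ∅ then 1 else 0 := by
      rw [Finset.sum_product, ← Finset.sum_mul_sum, sum_mu, sum_mu]
      by_cases hA : A = ∅ <;> by_cases hB : B = ∅ <;> simp [hA, hB]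
    rw [← h2, ← sub_eq_zero, ← Finset.sum_sub_distrib, Finset.sum_eq_single (A, B)] at h1
    · exact sub_eq_zero.1 h1
    · intro p hp hne
      rw [Finset.mem_product, mem_closedSets, mem_closedSets] at hp
      refine sub_eq_zero.2 (ih (p.1.card + p.2.card) ?_ p.1 p.2
        (hd.mono hp.1.1 hp.2.1) (hAB.mono hp.1.1 hp.2.1) rfl)
      by_contra hlt
      have e1 := Finset.card_le_card hp.1.1
      have e2 := Finset.card_le_card hp.2.1
      exact hne (Prod.ext (Finset.eq_of_subset_of_card_le hp.1.1 (by dsimp only; omega))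
        (Finset.eq_of_subset_of_card_le hp.2.1 (by dsimp only; omega)))
    · intro h
      exact absurd (Finset.mem_product.2 ⟨mem_closedSets.2 (InClosed.refl r A),
        mem_closedSets.2 (InClosed.refl r B)⟩) h

theorem MinClosed.mu_eq {r : β → β → Prop} {V C : Finset β} (h : MinClosed r V C) :
    mu r C = -1 := by
  have h1 := sum_mu r C
  rw [if_neg h.2.1.ne_empty, show closedSets r C = {∅, C} from ?_,
    Finset.sum_pair h.2.1.ne_empty.symm, mu_empty] at h1
  · omega
  · ext U
    rw [mem_closedSets, Finset.mem_insert, Finset.mem_singleton]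
    refine ⟨fun hU => h.2.2 U (h.1.trans hU) hU.1, ?_⟩
    rintro (rfl | rfl)
    · exact InClosed.empty _ _
    · exact InClosed.refl _ _

theorem MinClosed.disjoint_or_subset {r : β → β → Prop} {V C U : Finset β}
    (h : MinClosed r V C) (hU : InClosed r V U) : Disjoint U C ∨ C ⊆ U := by
  rcases h.2.2 _ (hU.inter h.1) Finset.inter_subset_right with h' | h'
  · exact Or.inl (Finset.disjoint_iff_inter_eq_empty.2 h')
  · exact Or.inr (Finset.inter_eq_right.1 h')

theorem mu_union_minClosed {r : β → β → Prop} {V U C : Finset β} (hC : MinClosed r V C)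
    (hU : InClosed r V U) (hd : Disjoint U C) : mu r (U ∪ C) = - mu r U := by
  rw [mu_union U C hd, hC.mu_eq, mul_neg_one]
  intro u hu c hc
  exact ⟨fun hr => Finset.disjoint_left.1 hd hu (hC.1.2 u (hU.1 hu) c hc hr),
    fun hr => Finset.disjoint_left.1 hd (hU.2 c (hC.1.1 hc) u hu hr) hc⟩

/-- Toggling C cancels all proper closed sets in the recursion for V. The set V itself has no
partner, since the arc leaving C prevents V \ C from being closed. -/
theorem mu_eq_zero_of_minClosed {r : β → β → Prop} (V C : Finset β) (hC : MinClosed r V C)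
    (h : ∃ c ∈ C, ∃ v ∈ V, v ∉ C ∧ r c v) : mu r V = 0 := by
  induction V using Finset.strongInduction with
  | H V ih =>
    have hV : V ≠ ∅ := (hC.2.1.mono hC.1.1).ne_empty
    have h1 := sum_mu r V
    rw [if_neg hV, ← Finset.add_sum_erase _ _ (mem_closedSets.2 (InClosed.refl r V)),
      sum_eq_zero_of_symmDiff _ C hC.2.1, add_zero] at h1
    · exact h1
    intro U hU hne
    rw [Finset.mem_erase, mem_closedSets] at hU
    rw [Finset.mem_erase, mem_closedSets]
    rcases hC.disjoint_or_subset hU.2 with hd | hs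
    · rw [hd.symmDiff_eq_sup]
      refine ⟨⟨?_, hU.2.union hC.1⟩, mu_union_minClosed hC hU.2 hd⟩
      -- If U ∪ C were all of V, the head of the arc leaving C would lie in U and force its tail
      -- into U.
      rintro rfl
      obtain ⟨c, hc, v, hv, hvC, hr⟩ := h
      have hvU : v ∈ U := (Finset.mem_union.1 hv).resolve_right hvC
      exact Finset.disjoint_left.1 hd (hU.2.2 c (hC.1.1 hc) v hvU hr) hc
    · rw [symmDiff_of_ge hs]
      -- As `mu` is nonzero on U, the induction hypothesis forbids arcs of U that leave C.
      have hiso : ∀ c ∈ C, ∀ u ∈ U, r c u → u ∈ C := by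
        intro c hc u hu hr
        by_contra hcu
        exact hne (ih U (hU.2.1.ssubset_of_ne hU.1) (hC.mono hU.2 hs) ⟨c, hc, u, hu, hcu, hr⟩)
      have hcl := hU.2.sdiff hiso
      refine ⟨⟨?_, hcl⟩, ?_⟩
      · rintro he
        obtain ⟨c, hc⟩ := hC.2.1
        have := hC.1.1 hc
        rw [← he, Finset.mem_sdiff] at this
        exact this.2 hc
      · have := mu_union_minClosed hC hcl Finset.sdiff_disjoint
        rw [Finset.sdiff_union_of_subset hs] at this
        omega

/-- Take a minimal closed C inside W. Either an arc leaves C, or C is isolated and can be removed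
from W without losing the given arc. -/
theorem mu_eq_zero {r : β → β → Prop} {V : Finset β} (W : Finset β) (hW : InClosed r V W)
    (h : ∃ w ∈ W, ∃ v ∈ V, v ∉ W ∧ r w v) : mu r V = 0 := by
  induction W using Finset.strongInduction with
  | H W ih =>
    obtain ⟨w, hw, v, hv, hvW, hr⟩ := h
    obtain ⟨C, hCW, hC⟩ := exists_minClosed W hW ⟨w, hw⟩
    by_cases hiso : ∃ c ∈ C, ∃ v ∈ V, v ∉ C ∧ r c v
    · exact mu_eq_zero_of_minClosed V C hC hiso
    · push Not at hiso
      have hcl : InClosed r V (W \ C) := hW.sdiff fun c hc u hu hr => by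
        by_contra hn
        exact hiso c hc u (hW.1 hu) hn hr
      refine ih (W \ C) ?_ hcl ⟨w, ?_, v, hv, ?_, hr⟩
      · obtain ⟨c, hc⟩ := hC.2.1
        exact ⟨Finset.sdiff_subset, fun hs => (Finset.mem_sdiff.1 (hs (hCW hc))).2 hc⟩
      · rw [Finset.mem_sdiff]
        exact ⟨hw, fun hc => hiso w hc v hv (fun hv' => hvW (hCW hv')) hr⟩
      · exact fun hv' => hvW (Finset.mem_sdiff.1 hv').1

end Digraph

/-! ### Skew-symmetric relations on literals -/

section Literals

variable {n : ℕ}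

/-- The negation of a literal. -/
def neg (a : Literal n) : Literal n := (a.1, !a.2)

@[simp] theorem neg_neg (a : Literal n) : neg (neg a) = a := by simp [neg]

@[simp] theorem neg_fst (a : Literal n) : (neg a).1 = a.1 := rfl

theorem eq_or_eq_neg {a b : Literal n} (h : a.1 = b.1) : a = b ∨ a = neg b := by
  obtain ⟨i, s⟩ := a
  obtain ⟨j, t⟩ := b
  obtain rfl : i = j := h
  cases s <;> cases t <;> simp [neg]

/-- The set of the negations of the elements of `U`. -/
def negSet (U : Finset (Literal n)) : Finset (Literal n) := U.image neg

@[simp] theorem mem_negSet {U : Finset (Literal n)} {a : Literal n} :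
    a ∈ negSet U ↔ neg a ∈ U := by
  simp only [negSet, Finset.mem_image]
  exact ⟨fun ⟨b, hb, h⟩ => by rw [← h, neg_neg]; exact hb, fun h => ⟨neg a, h, neg_neg a⟩⟩

@[simp] theorem negSet_negSet (U : Finset (Literal n)) : negSet (negSet U) = U := by
  ext a
  simp

/-- The literals on the variables in `V`. -/
def lits (V : Finset (Fin n)) : Finset (Literal n) := V ×ˢ Finset.univ

@[simp] theorem mem_lits {V : Finset (Fin n)} {a : Literal n} : a ∈ lits V ↔ a.1 ∈ V := by
  simp [lits]

/-- The variables of the elements of `U`. -/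
def vars (U : Finset (Literal n)) : Finset (Fin n) := U.image Prod.fst

theorem mem_vars {U : Finset (Literal n)} {i : Fin n} : i ∈ vars U ↔ ∃ a ∈ U, a.1 = i := by
  simp only [vars, Finset.mem_image]

theorem fst_mem_vars {U : Finset (Literal n)} {a : Literal n} :
    a.1 ∈ vars U ↔ a ∈ U ∨ neg a ∈ U := by
  rw [mem_vars]
  constructor
  · rintro ⟨b, hb, h⟩
    rcases eq_or_eq_neg h with rfl | rfl
    · exact Or.inl hb
    · exact Or.inr hb
  · rintro (h | h)
    · exact ⟨a, h, rfl⟩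
    · exact ⟨neg a, h, rfl⟩

theorem vars_negSet (U : Finset (Literal n)) : vars (negSet U) = vars U := by
  ext i
  simp only [mem_vars, mem_negSet]
  exact ⟨fun ⟨a, h, hi⟩ => ⟨neg a, h, hi⟩, fun ⟨a, h, hi⟩ => ⟨neg a, by simpa using h, hi⟩⟩

/-- No literal of `U` is the negation of a literal of `U`. -/
def Consistent (U : Finset (Literal n)) : Prop := ∀ a ∈ U, neg a ∉ U

theorem Consistent.mono {U W : Finset (Literal n)} (h : Consistent U) (hW : W ⊆ U) :
    Consistent W :=
  fun a ha hn => h a (hW ha) (hW hn)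

theorem Consistent.disjoint {U : Finset (Literal n)} (h : Consistent U) :
    Disjoint U (negSet U) :=
  Finset.disjoint_left.2 fun a ha hn => h a ha (mem_negSet.1 hn)

theorem Consistent.negSet {U : Finset (Literal n)} (h : Consistent U) :
    Consistent (negSet U) := by
  intro a ha hn
  rw [mem_negSet] at ha hn
  exact h _ ha hn

theorem Consistent.union {U W : Finset (Literal n)} (hU : Consistent U) (hW : Consistent W)
    (h : Disjoint U (TwoSat.negSet W)) : Consistent (U ∪ W) := by
  intro a ha hn
  rw [Finset.mem_union] at ha hn
  rw [Finset.disjoint_left] at h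
  rcases ha with ha | ha <;> rcases hn with hn | hn
  · exact hU a ha hn
  · exact h ha (mem_negSet.2 hn)
  · exact h hn (mem_negSet.2 (by rwa [neg_neg]))
  · exact hW a ha hn

/-- Reversing the arcs and negating the literals preserves the relation. -/
def Skew (r : Literal n → Literal n → Prop) : Prop := ∀ a b, r a b → r (neg b) (neg a)

open Classical in
/-- The consistent sets of literals on `V` which are closed under predecessors. -/
def consistentClosedSets (r : Literal n → Literal n → Prop) (V : Finset (Fin n)) :
    Finset (Finset (Literal n)) :=
  (closedSets r (lits V)).filter Consistent

theorem mem_consistentClosedSets {r : Literal n → Literal n → Prop} {V : Finset (Fin n)}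
    {U : Finset (Literal n)} :
    U ∈ consistentClosedSets r V ↔ InClosed r (lits V) U ∧ Consistent U := by
  simp only [consistentClosedSets, Finset.mem_filter, mem_closedSets]

/-- The sum of the Möbius function over the consistent closed sets of literals. -/
def tau (r : Literal n → Literal n → Prop) (V : Finset (Fin n)) : ℤ :=
  ∑ U ∈ consistentClosedSets r V, mu r U

theorem tau_empty (r : Literal n → Literal n → Prop) : tau r ∅ = 1 := by
  rw [tau, show consistentClosedSets r ∅ = {∅} from ?_, Finset.sum_singleton, mu_empty]
  ext U
  rw [mem_consistentClosedSets, Finset.mem_singleton]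
  constructor
  · intro h
    exact Finset.subset_empty.1 h.1.1
  · rintro rfl
    exact ⟨InClosed.empty _ _, fun a ha => absurd ha (Finset.notMem_empty _)⟩

theorem tau_congr {r r' : Literal n → Literal n → Prop} {V : Finset (Fin n)}
    (h : ∀ a ∈ lits V, ∀ b ∈ lits V, (r a b ↔ r' a b)) : tau r V = tau r' V := by
  rw [tau, tau, consistentClosedSets, consistentClosedSets, closedSets_congr h]
  refine Finset.sum_congr rfl fun U hU => ?_
  simp only [Finset.mem_filter, mem_closedSets] at hU
  exact mu_congr U fun a ha b hb => h a (hU.1.1 ha) b (hU.1.1 hb)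

/-- No arc inside `lits V` leaves `C`. -/
def OutClosed (r : Literal n → Literal n → Prop) (V : Finset (Fin n))
    (C : Finset (Literal n)) : Prop :=
  ∀ c ∈ C, ∀ v ∈ lits V, r c v → v ∈ C

theorem negSet_subset_lits {V : Finset (Fin n)} {C : Finset (Literal n)} (h : C ⊆ lits V) :
    negSet C ⊆ lits V := by
  intro a ha
  have := h (mem_negSet.1 ha)
  simpa using this

theorem OutClosed.inClosed_negSet {r : Literal n → Literal n → Prop} (hr : Skew r)
    {V : Finset (Fin n)} {C : Finset (Literal n)} (hC : C ⊆ lits V) (h : OutClosed r V C) :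
    InClosed r (lits V) (negSet C) := by
  refine ⟨negSet_subset_lits hC, fun v hv u hu hvu => ?_⟩
  rw [mem_negSet] at hu ⊢
  exact h _ hu _ (by simpa using hv) (hr _ _ hvu)

theorem InClosed.outClosed_negSet {r : Literal n → Literal n → Prop} (hr : Skew r)
    {V : Finset (Fin n)} {C : Finset (Literal n)} (h : InClosed r (lits V) C) :
    OutClosed r V (negSet C) := by
  intro c hc v hv hcv
  rw [mem_negSet] at hc ⊢
  exact h.2 _ (by simpa using hv) _ hc (hr _ _ hcv)

/-- By skewness the negation of U is closed under successors, so C minus it is closed under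
predecessors; minimality makes it empty or all of C. -/
theorem MinClosed.negSet_subset {r : Literal n → Literal n → Prop} (hr : Skew r)
    {V : Finset (Fin n)} {C U : Finset (Literal n)} (hC : MinClosed r (lits V) C)
    (hU : InClosed r (lits V) U) (hne : ¬ Disjoint U (negSet C)) : negSet C ⊆ U := by
  have h1 : InClosed r (lits V) (C \ negSet U) :=
    hC.1.sdiff fun c hc u hu hcu => hU.outClosed_negSet hr c hc u (hC.1.1 hu) hcu
  rcases hC.2.2 _ h1 Finset.sdiff_subset with h | h
  · rw [Finset.sdiff_eq_empty_iff_subset] at h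
    intro a ha
    simpa using h (mem_negSet.1 ha)
  · refine absurd (Finset.disjoint_left.2 fun a ha hc => ?_) hne
    rw [mem_negSet, ← h, Finset.mem_sdiff, mem_negSet, neg_neg] at hc
    exact hc.2 ha

theorem MinClosed.negSet {r : Literal n → Literal n → Prop} (hr : Skew r)
    {V : Finset (Fin n)} {C : Finset (Literal n)} (hC : MinClosed r (lits V) C)
    (ho : OutClosed r V C) : MinClosed r (lits V) (TwoSat.negSet C) := by
  refine ⟨ho.inClosed_negSet hr hC.1.1, ?_, fun U hU hUC => ?_⟩
  · obtain ⟨c, hc⟩ := hC.2.1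
    exact ⟨neg c, by simpa using hc⟩
  · by_cases hd : Disjoint U (TwoSat.negSet C)
    · exact Or.inl (by rwa [← Finset.inter_eq_left.2 hUC, ← Finset.disjoint_iff_inter_eq_empty])
    · exact Or.inr (hUC.antisymm (hC.negSet_subset hr hU hd))

/-- Sets avoiding the negation of C stay consistent when C is added, so toggling C reverses the sign
of every nonzero term. -/
theorem sum_mu_disjoint_negSet {r : Literal n → Literal n → Prop}
    {V : Finset (Fin n)} {C : Finset (Literal n)} (hC : MinClosed r (lits V) C)
    (hcons : Consistent C) :
    ∑ U ∈ (consistentClosedSets r V).filter (fun U => Disjoint U (negSet C)), mu r U = 0 := by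
  refine sum_eq_zero_of_symmDiff _ C hC.2.1 _ fun U hU hne => ?_
  rw [Finset.mem_filter, mem_consistentClosedSets] at hU
  obtain ⟨⟨hU1, hU2⟩, hU3⟩ := hU
  rw [Finset.mem_filter, mem_consistentClosedSets]
  rcases hC.disjoint_or_subset hU1 with hd | hs
  · rw [hd.symmDiff_eq_sup]
    exact ⟨⟨⟨hU1.union hC.1, hU2.union hcons hU3⟩,
      Finset.disjoint_union_left.2 ⟨hU3, hcons.disjoint⟩⟩, mu_union_minClosed hC hU1 hd⟩
  · rw [symmDiff_of_ge hs]
    have hiso : ∀ c ∈ C, ∀ u ∈ U, r c u → u ∈ C := by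
      intro c hc u hu hcu
      by_contra hn
      exact hne (mu_eq_zero_of_minClosed U C (hC.mono hU1 hs) ⟨c, hc, u, hu, hn, hcu⟩)
    have hcl := hU1.sdiff hiso
    refine ⟨⟨⟨hcl, hU2.mono Finset.sdiff_subset⟩, hU3.mono_left Finset.sdiff_subset⟩, ?_⟩
    have := mu_union_minClosed hC hcl Finset.sdiff_disjoint
    rw [Finset.sdiff_union_of_subset hs] at this
    change mu r (U \ C) = _
    omega

theorem tau_eq_sum {r : Literal n → Literal n → Prop} (hr : Skew r)
    {V : Finset (Fin n)} {C : Finset (Literal n)} (hC : MinClosed r (lits V) C)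
    (hcons : Consistent C) :
    tau r V = ∑ U ∈ (consistentClosedSets r V).filter (fun U => negSet C ⊆ U), mu r U := by
  rw [tau, ← Finset.sum_filter_add_sum_filter_not _ (fun U => Disjoint U (negSet C)),
    sum_mu_disjoint_negSet hC hcons, zero_add]
  refine Finset.sum_congr (Finset.filter_congr fun U hU => ?_) fun _ _ => rfl
  rw [mem_consistentClosedSets] at hU
  refine ⟨hC.negSet_subset hr hU.1, fun h hd => ?_⟩
  obtain ⟨c, hc⟩ := hC.2.1
  have hc' : neg c ∈ negSet C := by simpa using hc
  exact Finset.disjoint_left.1 hd (h hc') hc'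

/-- The mirror image ¬v → ¬c of the given arc leaves the set U minus the negation of C, which is
closed in U. -/
theorem mu_eq_zero_of_negSet_subset {r : Literal n → Literal n → Prop} (hr : Skew r)
    {V : Finset (Fin n)} {C U : Finset (Literal n)} (hC : InClosed r (lits V) C)
    (hU : U ⊆ lits V) (hCU : negSet C ⊆ U)
    (h : ∃ c ∈ C, ∃ v, neg v ∈ U ∧ v ∉ C ∧ r c v) : mu r U = 0 := by
  obtain ⟨c, hc, v, hvU, hvC, hcv⟩ := h
  have hc' : neg c ∈ negSet C := by simpa using hc
  refine mu_eq_zero (U \ negSet C) ?_ ⟨neg v, ?_, neg c, hCU hc', ?_, hr _ _ hcv⟩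
  · refine (InClosed.refl r U).sdiff fun c hc u hu hcu => ?_
    exact hC.outClosed_negSet hr c hc u (hU hu) hcu
  · rw [Finset.mem_sdiff, mem_negSet, neg_neg]
    exact ⟨hvU, hvC⟩
  · exact fun h => (Finset.mem_sdiff.1 h).2 hc'

/-- In each surviving U, the mirror of an arc leaving C ends in the negation of C, hence in U;
closedness puts its tail in U too, and `mu` vanishes there. -/
theorem tau_eq_zero {r : Literal n → Literal n → Prop} (hr : Skew r)
    {V : Finset (Fin n)} {C : Finset (Literal n)} (hC : MinClosed r (lits V) C)
    (hcons : Consistent C) (ho : ¬ OutClosed r V C) : tau r V = 0 := by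
  rw [tau_eq_sum hr hC hcons]
  refine Finset.sum_eq_zero fun U hU => ?_
  rw [Finset.mem_filter, mem_consistentClosedSets] at hU
  simp only [OutClosed, not_forall] at ho
  obtain ⟨c, hc, v, hv, hcv, hvC⟩ := ho
  refine mu_eq_zero_of_negSet_subset hr hC.1 hU.1.1.1 hU.2 ⟨c, hc, v, ?_, hvC, hcv⟩
  exact hU.1.1.2 _ (by simpa using hv) _ (hU.2 (by simpa using hc)) (hr _ _ hcv)

theorem inClosed_lits_sdiff {r : Literal n → Literal n → Prop} (hr : Skew r)
    {V : Finset (Fin n)} {C : Finset (Literal n)} (hC : MinClosed r (lits V) C)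
    (ho : OutClosed r V C) : InClosed r (lits V) (lits (V \ vars C)) := by
  refine ⟨fun a ha => ?_, fun v hv u hu hvu => ?_⟩
  · rw [mem_lits, Finset.mem_sdiff] at ha
    exact mem_lits.2 ha.1
  · rw [mem_lits, Finset.mem_sdiff] at hu ⊢
    refine ⟨mem_lits.1 hv, fun h => hu.2 ?_⟩
    rw [fst_mem_vars] at h ⊢
    refine h.imp (fun h => ho _ h _ (mem_lits.2 hu.1) hvu) fun h => ?_
    exact hC.1.2 _ (by simpa using hu.1) _ h (hr _ _ hvu)

theorem disjoint_of_subset_lits_sdiff {V : Finset (Fin n)} {C U : Finset (Literal n)}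
    (hU : U ⊆ lits (V \ vars C)) : Disjoint U C := by
  refine Finset.disjoint_left.2 fun a ha hc => ?_
  have := hU ha
  rw [mem_lits, Finset.mem_sdiff, fst_mem_vars] at this
  exact this.2 (Or.inl hc)

/-- Every surviving set contains the negation of C, now an isolated component. Deleting it leaves a
consistent closed set on the remaining variables and changes the sign. -/
theorem tau_eq_neg {r : Literal n → Literal n → Prop} (hr : Skew r)
    {V : Finset (Fin n)} {C : Finset (Literal n)} (hC : MinClosed r (lits V) C)
    (hcons : Consistent C) (ho : OutClosed r V C) : tau r V = - tau r (V \ vars C) := by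
  rw [tau_eq_sum hr hC hcons, tau, ← Finset.sum_neg_distrib]
  have hN := hC.negSet hr ho
  have hd : ∀ U, U ⊆ lits (V \ vars C) → Disjoint U (negSet C) := fun U hU =>
    disjoint_of_subset_lits_sdiff (by rwa [vars_negSet])
  have hcl := inClosed_lits_sdiff hr hC ho
  symm
  refine Finset.sum_bij' (fun U _ => U ∪ negSet C) (fun U _ => U \ negSet C) ?_ ?_ ?_ ?_ ?_
  · intro U hU
    rw [mem_consistentClosedSets] at hU
    rw [Finset.mem_filter, mem_consistentClosedSets]
    refine ⟨⟨(hcl.trans hU.1).union hN.1, hU.2.union hcons.negSet ?_⟩,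
      Finset.subset_union_right⟩
    rw [negSet_negSet]
    exact disjoint_of_subset_lits_sdiff hU.1.1
  · intro U hU
    rw [Finset.mem_filter, mem_consistentClosedSets] at hU
    rw [mem_consistentClosedSets]
    have h1 : U \ negSet C ⊆ lits (V \ vars C) := by
      intro a ha
      rw [Finset.mem_sdiff, mem_negSet] at ha
      rw [mem_lits, Finset.mem_sdiff, fst_mem_vars, not_or]
      refine ⟨mem_lits.1 (hU.1.1.1 ha.1), fun hc => ?_, ha.2⟩
      exact hU.1.2 a ha.1 (hU.2 (by simpa using hc))
    have h2 : InClosed r (lits V) (U \ negSet C) :=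
      hU.1.1.sdiff fun c hc u hu hcu => hC.1.outClosed_negSet hr c hc u (hU.1.1.1 hu) hcu
    exact ⟨h2.mono hcl.1 h1, hU.1.2.mono Finset.sdiff_subset⟩
  · intro U hU
    rw [mem_consistentClosedSets] at hU
    exact Finset.union_sdiff_cancel_right (hd U hU.1.1)
  · intro U hU
    rw [Finset.mem_filter] at hU
    exact Finset.sdiff_union_of_subset hU.2
  · intro U hU
    rw [mem_consistentClosedSets] at hU
    exact (mu_union_minClosed hN (hcl.trans hU.1) (hd U hU.1.1)).symm

/-- `U` contains exactly one of the two literals of each variable in `V`, and there is no arc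
between `U` and the negations of its elements. -/
def Separating (r : Literal n → Literal n → Prop) (V : Finset (Fin n))
    (U : Finset (Literal n)) : Prop :=
  U ⊆ lits V ∧ (∀ a ∈ lits V, (a ∈ U ↔ neg a ∉ U)) ∧ NoArcs r U (lits V \ U)

theorem Separating.consistent {r : Literal n → Literal n → Prop} {V : Finset (Fin n)}
    {U : Finset (Literal n)} (h : Separating r V U) : Consistent U :=
  fun a ha => (h.2.1 a (h.1 ha)).1 ha

theorem Separating.inClosed {r : Literal n → Literal n → Prop} {V : Finset (Fin n)}
    {U : Finset (Literal n)} (h : Separating r V U) : InClosed r (lits V) U :=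
  ⟨h.1, fun v hv u hu hvu => by
    by_contra hn
    exact (h.2.2 u hu v (Finset.mem_sdiff.2 ⟨hv, hn⟩)).2 hvu⟩

theorem Separating.outClosed {r : Literal n → Literal n → Prop} {V : Finset (Fin n)}
    {U : Finset (Literal n)} (h : Separating r V U) : OutClosed r V U :=
  fun u hu v hv huv => by
    by_contra hn
    exact (h.2.2 u hu v (Finset.mem_sdiff.2 ⟨hv, hn⟩)).1 huv

theorem Separating.mono {r : Literal n → Literal n → Prop} {V W : Finset (Fin n)}
    {U : Finset (Literal n)} (h : Separating r V U) (hW : W ⊆ V) :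
    Separating r W (U ∩ lits W) := by
  refine ⟨Finset.inter_subset_right, fun a ha => ?_, h.2.2.mono Finset.inter_subset_left ?_⟩
  · have ha' := mem_lits.1 ha
    simp only [Finset.mem_inter, mem_lits, neg_fst, ha', and_true]
    exact h.2.1 a (mem_lits.2 (hW ha'))
  · intro a ha
    rw [Finset.mem_sdiff, mem_lits, Finset.mem_inter, mem_lits] at ha
    rw [Finset.mem_sdiff, mem_lits]
    exact ⟨hW ha.1, fun h => ha.2 ⟨h, ha.1⟩⟩

theorem Separating.union {r : Literal n → Literal n → Prop} {V W : Finset (Fin n)}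
    {U U' : Finset (Literal n)} (h : Separating r V U) (h' : Separating r W U')
    (hd : Disjoint V W) (hr : NoArcs r (lits V) (lits W)) : Separating r (V ∪ W) (U ∪ U') := by
  have hV : ∀ a, a.1 ∈ V → a ∉ U' := fun a ha hU =>
    Finset.disjoint_left.1 hd ha (mem_lits.1 (h'.1 hU))
  have hW : ∀ a, a.1 ∈ W → a ∉ U := fun a ha hU =>
    Finset.disjoint_left.1 hd (mem_lits.1 (h.1 hU)) ha
  refine ⟨fun a ha => ?_, fun a ha => ?_, fun u hu v hv => ?_⟩
  · rw [mem_lits, Finset.mem_union]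
    exact (Finset.mem_union.1 ha).imp (fun ha => mem_lits.1 (h.1 ha))
      fun ha => mem_lits.1 (h'.1 ha)
  · rw [mem_lits, Finset.mem_union] at ha
    rw [Finset.mem_union, Finset.mem_union]
    rcases ha with ha | ha
    · have := h.2.1 a (mem_lits.2 ha)
      have h1 := hV a ha
      have h2 := hV (neg a) ha
      tauto
    · have := h'.2.1 a (mem_lits.2 ha)
      have h1 := hW a ha
      have h2 := hW (neg a) ha
      tauto
  · rw [Finset.mem_sdiff, mem_lits, Finset.mem_union, Finset.mem_union, not_or] at hv
    rcases Finset.mem_union.1 hu with hu | hu <;> rcases hv.1 with hv1 | hv1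
    · exact h.2.2 u hu v (Finset.mem_sdiff.2 ⟨mem_lits.2 hv1, hv.2.1⟩)
    · exact hr u (h.1 hu) v (mem_lits.2 hv1)
    · exact (hr v (mem_lits.2 hv1) u (h'.1 hu)).symm
    · exact h'.2.2 u hu v (Finset.mem_sdiff.2 ⟨mem_lits.2 hv1, hv.2.2⟩)

theorem mu_eq_neg_of_subset {r : Literal n → Literal n → Prop} (hr : Skew r)
    {V : Finset (Fin n)} {C U : Finset (Literal n)} (hC : MinClosed r (lits V) C)
    (ho : OutClosed r V C) (hU : InClosed r (lits V) U) (hcons : Consistent U) (hCU : C ⊆ U) :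
    mu r U = - mu r (U ∩ lits (V \ vars C)) := by
  have hcl := inClosed_lits_sdiff hr hC ho
  rw [← mu_union_minClosed hC (hU.inter hcl)
    (disjoint_of_subset_lits_sdiff Finset.inter_subset_right)]
  congr 1
  ext a
  rw [Finset.mem_union, Finset.mem_inter, mem_lits, Finset.mem_sdiff, fst_mem_vars, not_or]
  constructor
  · intro ha
    by_cases hc : a ∈ C
    · exact Or.inr hc
    · exact Or.inl ⟨ha, mem_lits.1 (hU.1 ha), hc, fun h => hcons a ha (hCU h)⟩
  · rintro (h | h)
    · exact h.1
    · exact hCU h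

/-- Both sides obey the same recursion: U contains a minimal closed C or its negation. If C is
isolated, removing its variables changes both signs; otherwise both sides vanish. -/
theorem Separating.tau_eq {r : Literal n → Literal n → Prop} (hr : Skew r)
    {V : Finset (Fin n)} {U : Finset (Literal n)} (h : Separating r V U) :
    tau r V = mu r U := by
  induction V using Finset.strongInduction generalizing U with
  | H V ih =>
    rcases V.eq_empty_or_nonempty with rfl | ⟨i, hi⟩
    · have : U = ∅ := Finset.subset_empty.1 h.1
      rw [this, tau_empty, mu_empty]
    · obtain ⟨C, -, hC⟩ := exists_minClosed (lits V) (InClosed.refl r _)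
        ⟨(i, true), mem_lits.2 hi⟩
      have hneg : Disjoint U C → negSet C ⊆ U := fun hd a ha => by
        rw [mem_negSet] at ha
        refine (h.2.1 a (negSet_subset_lits hC.1.1 (mem_negSet.2 ha))).2 fun hn => ?_
        exact Finset.disjoint_left.1 hd hn ha
      have hcons : Consistent C := by
        rcases hC.disjoint_or_subset h.inClosed with hd | hs
        · have := (h.consistent.mono (hneg hd)).negSet
          rwa [negSet_negSet] at this
        · exact h.consistent.mono hs
      by_cases ho : OutClosed r V C
      · have hss : V \ vars C ⊂ V := by
          obtain ⟨c, hc⟩ := hC.2.1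
          refine ⟨Finset.sdiff_subset, fun hs => ?_⟩
          exact (Finset.mem_sdiff.1 (hs (mem_lits.1 (hC.1.1 hc)))).2 (mem_vars.2 ⟨c, hc, rfl⟩)
        rw [tau_eq_neg hr hC hcons ho, ih _ hss (h.mono hss.1)]
        rcases hC.disjoint_or_subset h.inClosed with hd | hs
        · rw [mu_eq_neg_of_subset hr (hC.negSet hr ho) (hC.1.outClosed_negSet hr) h.inClosed
            h.consistent (hneg hd), vars_negSet]
        · rw [mu_eq_neg_of_subset hr hC ho h.inClosed h.consistent hs]
      · rw [tau_eq_zero hr hC hcons ho]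
        simp only [OutClosed, not_forall] at ho
        obtain ⟨c, hc, v, hv, hcv, hvC⟩ := ho
        symm
        rcases hC.disjoint_or_subset h.inClosed with hd | hs
        · refine mu_eq_zero_of_negSet_subset hr hC.1 h.1 (hneg hd) ⟨c, hc, v, ?_, hvC, hcv⟩
          refine (h.2.1 (neg v) (by simpa using hv)).2 fun hn => ?_
          rw [neg_neg] at hn
          exact Finset.disjoint_left.1 hd (h.inClosed.2 c (hC.1.1 hc) v hn hcv) hc
        · exact mu_eq_zero_of_minClosed U C (hC.mono h.inClosed hs)
            ⟨c, hc, v, h.outClosed c (hs hc) v hv hcv, hvC, hcv⟩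

/-- The assignment `x` satisfies all implications of `r`. -/
def Respects (r : Literal n → Literal n → Prop) (x : Fin n → Bool) : Prop :=
  ∀ a b, r a b → x a.1 = a.2 → x b.1 = b.2

/-- The literals of C that are false under x form a closed set, so by minimality C is uniformly true
or uniformly false and cannot contain a complementary pair. -/
theorem Respects.consistent {r : Literal n → Literal n → Prop} {x : Fin n → Bool}
    (hx : Respects r x) {V : Finset (Fin n)} {C : Finset (Literal n)}
    (hC : MinClosed r (lits V) C) : Consistent C := by
  have h1 : InClosed r (lits V) (C.filter fun a => x a.1 ≠ a.2) := by
    refine ⟨(Finset.filter_subset _ _).trans hC.1.1, fun v hv u hu hvu => ?_⟩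
    rw [Finset.mem_filter] at hu ⊢
    exact ⟨hC.1.2 v hv u hu.1 hvu, fun h => hu.2 (hx v u hvu h)⟩
  intro a ha hn
  rcases hC.2.2 _ h1 (Finset.filter_subset _ _) with h | h
  · have e1 := (Finset.filter_eq_empty_iff.1 h) ha
    have e2 := (Finset.filter_eq_empty_iff.1 h) hn
    simp [neg] at e1 e2
    simp [e1] at e2
  · have e1 := (Finset.filter_eq_self.1 h) a ha
    have e2 := (Finset.filter_eq_self.1 h) _ hn
    simp [neg] at e1 e2
    exact e1 e2

/-- A nonzero `tau` forces each successive minimal closed set to be isolated; collecting one of each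
complementary pair builds the separating set. -/
theorem exists_separating {r : Literal n → Literal n → Prop} (hr : Skew r) {x : Fin n → Bool}
    (hx : Respects r x) {V : Finset (Fin n)} (h : tau r V ≠ 0) : ∃ U, Separating r V U := by
  induction V using Finset.strongInduction with
  | H V ih =>
    rcases V.eq_empty_or_nonempty with rfl | ⟨i, hi⟩
    · exact ⟨∅, subset_rfl, fun a ha => by simp at ha, fun a ha => by simp at ha⟩
    · obtain ⟨C, -, hC⟩ := exists_minClosed (lits V) (InClosed.refl r _)
        ⟨(i, true), mem_lits.2 hi⟩
      have hcons := hx.consistent hC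
      have ho : OutClosed r V C := by
        by_contra ho
        exact h (tau_eq_zero hr hC hcons ho)
      have hcl := inClosed_lits_sdiff hr hC ho
      rw [tau_eq_neg hr hC hcons ho, neg_ne_zero] at h
      have hss : V \ vars C ⊂ V := by
        obtain ⟨c, hc⟩ := hC.2.1
        refine ⟨Finset.sdiff_subset, fun hs => ?_⟩
        exact (Finset.mem_sdiff.1 (hs (mem_lits.1 (hC.1.1 hc)))).2 (mem_vars.2 ⟨c, hc, rfl⟩)
      obtain ⟨U, hU⟩ := ih _ hss h
      have hvC : vars C ⊆ V := fun i hi => by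
        obtain ⟨a, ha, rfl⟩ := mem_vars.1 hi
        exact mem_lits.1 (hC.1.1 ha)
      have hsep : Separating r (vars C) C := by
        refine ⟨fun a ha => ?_, fun a ha => ?_, fun a ha b hb => ?_⟩
        · rw [mem_lits, fst_mem_vars]
          exact Or.inl ha
        · rw [mem_lits, fst_mem_vars] at ha
          have := hcons a
          tauto
        · rw [Finset.mem_sdiff, mem_lits] at hb
          exact ⟨fun h => hb.2 (ho a ha b (mem_lits.2 (hvC hb.1)) h),
            fun h => hb.2 (hC.1.2 b (mem_lits.2 (hvC hb.1)) a ha h)⟩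
      have hno : NoArcs r (lits (V \ vars C)) (lits (vars C)) := by
        intro a ha b hb
        have hb' : b ∈ lits V := mem_lits.2 (hvC (mem_lits.1 hb))
        have key : ∀ a ∈ lits (V \ vars C), ∀ b ∈ lits (vars C), ¬ r b a := by
          intro a ha b hb hba
          have h1 := hcl.2 b (mem_lits.2 (hvC (mem_lits.1 hb))) a ha hba
          rw [mem_lits, Finset.mem_sdiff] at h1
          exact h1.2 (mem_lits.1 hb)
        refine ⟨fun hab => ?_, key a ha b hb⟩
        exact key (neg a) (by simpa using ha) (neg b) (by simpa using hb) (hr _ _ hab)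
      refine ⟨U ∪ C, ?_⟩
      have := hU.union hsep Finset.sdiff_disjoint hno
      rwa [Finset.sdiff_union_of_subset hvC] at this

end Literals

/-! ### Separating sets and the square of `tau` -/

section Transversals

variable {n : ℕ}

theorem separating_iff {r : Literal n → Literal n → Prop} {V : Finset (Fin n)}
    {U : Finset (Literal n)} :
    Separating r V U ↔ U ⊆ lits V ∧ (∀ a ∈ lits V, (a ∈ U ↔ neg a ∉ U)) ∧
      ∀ a ∈ lits V, ∀ b ∈ lits V, r a b → (a ∈ U ↔ b ∈ U) := by
  refine ⟨fun h => ⟨h.1, h.2.1, fun a ha b hb hab => ⟨fun h' => h.outClosed a h' b hb hab,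
    fun h' => h.inClosed.2 a ha b h' hab⟩⟩, fun h => ⟨h.1, h.2.1, fun a ha b hb => ?_⟩⟩
  rw [Finset.mem_sdiff] at hb
  exact ⟨fun hab => hb.2 ((h.2.2 a (h.1 ha) b hb.1 hab).1 ha),
    fun hab => hb.2 ((h.2.2 b hb.1 a (h.1 ha) hab).2 ha)⟩

theorem noArcs_lits_iff {r : Literal n → Literal n → Prop} {V K : Finset (Fin n)}
    (hK : K ⊆ V) :
    NoArcs r (lits K) (lits (V \ K)) ↔
      ∀ a ∈ lits V, ∀ b ∈ lits V, r a b → (a.1 ∈ K ↔ b.1 ∈ K) := by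
  simp only [NoArcs, mem_lits, Finset.mem_sdiff]
  constructor
  · intro h a ha b hb hab
    by_contra hn
    by_cases h' : a.1 ∈ K
    · exact (h a h' b ⟨hb, fun hb' => hn (iff_of_true h' hb')⟩).1 hab
    · by_cases hb' : b.1 ∈ K
      · exact (h b hb' a ⟨ha, h'⟩).2 hab
      · exact hn (iff_of_false h' hb')
  · intro h a ha b hb
    exact ⟨fun hab => hb.2 ((h a (hK ha) b hb.1 hab).1 ha),
      fun hab => hb.2 ((h b hb.1 a (hK ha) hab).2 ha)⟩

/-- Replace the literals of `U` on the variables in `K` by their negations. -/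
def flip (V K : Finset (Fin n)) (U : Finset (Literal n)) : Finset (Literal n) :=
  (lits V).filter fun a => ¬ (a ∈ U ↔ a.1 ∈ K)

theorem Separating.flip {r : Literal n → Literal n → Prop} {V K : Finset (Fin n)}
    {U : Finset (Literal n)} (h : Separating r V U) (hK : K ⊆ V)
    (hr : NoArcs r (lits K) (lits (V \ K))) : Separating r V (flip V K U) := by
  rw [noArcs_lits_iff hK] at hr
  rw [separating_iff] at h ⊢
  refine ⟨Finset.filter_subset _ _, fun a ha => ?_, fun a ha b hb hab => ?_⟩
  · have := h.2.1 a ha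
    rw [mem_lits] at ha
    simp only [TwoSat.flip, Finset.mem_filter, mem_lits, ha, true_and, neg_fst]
    tauto
  · have h1 := h.2.2 a ha b hb hab
    have h2 := hr a ha b hb hab
    rw [mem_lits] at ha hb
    simp only [TwoSat.flip, Finset.mem_filter, mem_lits, ha, hb, true_and]
    tauto

-- Relative to a fixed separating set, flipping matches the unlinked variable sets K with all
-- separating sets. With no separating set both sides are zero, since nonzero factors on K and V \ K
-- would yield sets that glue together.
open Classical in
theorem sum_tau_mul_tau {r : Literal n → Literal n → Prop} (hr : Skew r) {x : Fin n → Bool}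
    (hx : Respects r x) (V : Finset (Fin n)) :
    ∑ K ∈ V.powerset with NoArcs r (lits K) (lits (V \ K)), tau r K * tau r (V \ K) =
      ∑ U ∈ (lits V).powerset with Separating r V U, mu r U := by
  by_cases hex : ∃ U, Separating r V U
  · obtain ⟨U₀, h₀⟩ := hex
    refine Finset.sum_bij' (fun K _ => flip V K U₀)
      (fun U _ => V.filter fun i => ¬ ((i, true) ∈ U₀ ↔ (i, true) ∈ U)) ?_ ?_ ?_ ?_ ?_
    · intro K hK
      rw [Finset.mem_filter, Finset.mem_powerset] at hK ⊢
      exact ⟨Finset.filter_subset _ _, h₀.flip hK.1 hK.2⟩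
    · intro U hU
      rw [Finset.mem_filter, Finset.mem_powerset] at hU ⊢
      refine ⟨Finset.filter_subset _ _, ?_⟩
      rw [noArcs_lits_iff (Finset.filter_subset _ _)]
      have h1 := separating_iff.1 h₀
      have h2 := separating_iff.1 hU.2
      -- Whether two separating sets agree at a literal depends only on its variable, so testing
      -- positive literals suffices.
      have key : ∀ a ∈ lits V, (((a.1, true) ∈ U₀ ↔ (a.1, true) ∈ U) ↔ (a ∈ U₀ ↔ a ∈ U)) := by
        intro a ha
        have e1 := h1.2.1 a ha
        have e2 := h2.2.1 a ha
        obtain ⟨i, s⟩ := a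
        cases s
        · simp only [neg, Bool.not_false] at e1 e2 ⊢
          tauto
        · rfl
      intro a ha b hb hab
      have e1 := h1.2.2 a ha b hb hab
      have e2 := h2.2.2 a ha b hb hab
      have e3 := key a ha
      have e4 := key b hb
      rw [mem_lits] at ha hb
      simp only [Finset.mem_filter, ha, hb, true_and, e3, e4, e1, e2]
    · intro K hK
      rw [Finset.mem_filter, Finset.mem_powerset] at hK
      ext i
      simp only [flip, Finset.mem_filter, mem_lits]
      have := @hK.1 i
      tauto
    · intro U hU
      rw [Finset.mem_filter, Finset.mem_powerset] at hU
      ext a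
      have h1 := h₀.2.1 a
      have h2 := hU.2.2.1 a
      have h3 := @hU.2.1 a
      simp only [flip, Finset.mem_filter, mem_lits] at h1 h2 h3 ⊢
      obtain ⟨i, s⟩ := a
      cases s
      · simp only [neg, Bool.not_false] at h1 h2 h3 ⊢
        tauto
      · tauto
    · intro K hK
      rw [Finset.mem_filter, Finset.mem_powerset] at hK
      -- All separating sets have the same `mu`, namely `tau` on V, and on U₀ it factors along K.
      rw [← (h₀.flip hK.1 hK.2).tau_eq hr, h₀.tau_eq hr, (h₀.mono hK.1).tau_eq hr,
        (h₀.mono Finset.sdiff_subset).tau_eq hr, ← mu_union]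
      · rw [← Finset.inter_union_distrib_left]
        congr 1
        rw [Finset.inter_eq_left]
        intro a ha
        have := mem_lits.1 (h₀.1 ha)
        rw [Finset.mem_union, mem_lits, mem_lits, Finset.mem_sdiff]
        tauto
      · refine Finset.disjoint_left.2 fun a ha hb => ?_
        simp only [Finset.mem_inter, mem_lits, Finset.mem_sdiff] at ha hb
        exact hb.2.2 ha.2
      · exact hK.2.mono Finset.inter_subset_right Finset.inter_subset_right
  · rw [Finset.sum_eq_zero, Finset.sum_eq_zero]
    · intro U hU
      exact absurd ⟨U, (Finset.mem_filter.1 hU).2⟩ hex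
    · intro K hK
      rw [Finset.mem_filter, Finset.mem_powerset] at hK
      by_contra hne
      obtain ⟨U₁, h₁⟩ := exists_separating hr hx (left_ne_zero_of_mul hne)
      obtain ⟨U₂, h₂⟩ := exists_separating hr hx (right_ne_zero_of_mul hne)
      have := h₁.union h₂ Finset.disjoint_sdiff hK.2
      rw [Finset.union_sdiff_of_subset hK.1] at this
      exact hex ⟨_, this⟩

theorem Consistent.card_vars {U : Finset (Literal n)} (h : Consistent U) :
    (vars U).card = U.card := by
  refine Finset.card_image_of_injOn fun a ha b hb hab => ?_
  rcases eq_or_eq_neg hab with h' | h'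
  · exact h'
  · exact absurd (h' ▸ ha) (h b hb)

open Classical in
theorem card_consistent_vars_eq (J : Finset (Fin n)) :
    (((lits J).powerset.filter fun U => Consistent U ∧ vars U = J).card) = 2 ^ J.card := by
  rw [← Finset.card_powerset]
  refine Finset.card_bij' (fun U _ => J.filter fun i => (i, true) ∈ U)
    (fun P _ => (lits J).filter fun a => (a.2 = true ↔ a.1 ∈ P)) ?_ ?_ ?_ ?_
  · intro U _
    exact Finset.mem_powerset.2 (Finset.filter_subset _ _)
  · intro P hP
    rw [Finset.mem_filter, Finset.mem_powerset]
    refine ⟨Finset.filter_subset _ _, fun a ha hn => ?_, ?_⟩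
    · rw [Finset.mem_filter] at ha hn
      obtain ⟨i, s⟩ := a
      cases s <;> simp [neg] at ha hn <;> tauto
    · ext i
      rw [mem_vars]
      constructor
      · rintro ⟨a, ha, rfl⟩
        exact mem_lits.1 (Finset.mem_filter.1 ha).1
      · intro hi
        exact ⟨(i, decide (i ∈ P)), by simp [hi], rfl⟩
  · intro U hU
    simp only [Finset.mem_filter, Finset.mem_powerset] at hU
    obtain ⟨h1, h2, h3⟩ := hU
    ext ⟨i, s⟩
    have e1 : i ∈ J ↔ _ := h3 ▸ fst_mem_vars (U := U) (a := (i, s))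
    have e2 := h2 (i, s)
    have e3 := @h1 (i, s)
    simp only [Finset.mem_filter, mem_lits] at *
    cases s <;> simp [neg] at * <;> tauto
  · intro P hP
    rw [Finset.mem_powerset] at hP
    ext i
    have := @hP i
    simp
    tauto

open Classical in
theorem sum_consistent {M : Type*} [CommSemiring M] (V : Finset (Fin n))
    (g : Finset (Fin n) → M) :
    ∑ U ∈ (lits V).powerset with Consistent U, g (vars U) =
      ∑ J ∈ V.powerset, 2 ^ J.card * g J := by
  have hmaps : ∀ U ∈ (lits V).powerset.filter Consistent, vars U ∈ V.powerset := by
    intro U hU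
    rw [Finset.mem_filter, Finset.mem_powerset] at hU
    rw [Finset.mem_powerset]
    intro i hi
    obtain ⟨a, ha, rfl⟩ := mem_vars.1 hi
    exact mem_lits.1 (hU.1 ha)
  rw [← Finset.sum_fiberwise_of_maps_to hmaps]
  refine Finset.sum_congr rfl fun J hJ => ?_
  rw [Finset.mem_powerset] at hJ
  rw [Finset.sum_congr rfl (g := fun _ => g J) fun U hU => by rw [(Finset.mem_filter.1 hU).2],
    Finset.sum_const, nsmul_eq_mul]
  congr 1
  rw [← Nat.cast_ofNat, ← Nat.cast_pow, ← card_consistent_vars_eq J, Finset.filter_filter]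
  congr 2
  ext U
  simp only [Finset.mem_filter, Finset.mem_powerset]
  refine and_congr_left fun h => ⟨fun _ a ha => ?_, fun h' a ha => ?_⟩
  · rw [mem_lits, ← h.2, fst_mem_vars]
    exact Or.inl ha
  · exact mem_lits.2 (hJ (mem_lits.1 (h' ha)))

end Transversals

/-! ### Weighted sums over subsets -/

section Weights

variable {R : Type*} [CommRing R] {γ : Type*}

/-- The sum of `f` over the subsets of `A`, each subset having weight `w` to its cardinality. -/
def wsum (w : R) (A : Finset γ) (f : Finset γ → R) : R :=
  ∑ E ∈ A.powerset, w ^ E.card * f E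

theorem wsum_congr {w : R} {A : Finset γ} {f g : Finset γ → R} (h : ∀ E ⊆ A, f E = g E) :
    wsum w A f = wsum w A g :=
  Finset.sum_congr rfl fun E hE => by rw [h E (Finset.mem_powerset.1 hE)]

theorem wsum_one (w : R) (A : Finset γ) : wsum w A (fun _ => 1) = (1 + w) ^ A.card := by
  rw [wsum, add_comm, ← Finset.sum_pow_mul_eq_add_pow]
  simp

theorem wsum_subset {w : R} {A B : Finset γ} (hB : B ⊆ A) {f : Finset γ → R}
    (hf : ∀ E ⊆ A, ¬ E ⊆ B → f E = 0) : wsum w A f = wsum w B f := by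
  symm
  refine Finset.sum_subset (Finset.powerset_mono.2 hB) fun E hE hE' => ?_
  rw [Finset.mem_powerset] at hE hE'
  rw [hf E hE hE', mul_zero]

theorem wsum_sum {w : R} {A : Finset γ} {ι : Type*} (s : Finset ι) (f : ι → Finset γ → R) :
    wsum w A (fun E => ∑ i ∈ s, f i E) = ∑ i ∈ s, wsum w A (f i) := by
  simp only [wsum, Finset.mul_sum]
  exact Finset.sum_comm

theorem wsum_image {w : R} {δ : Type*} [DecidableEq δ] {A : Finset γ} {e : γ → δ}
    (he : Set.InjOn e A) (f : Finset δ → R) :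
    wsum w (A.image e) f = wsum w A fun E => f (E.image e) := by
  symm
  refine Finset.sum_bij (fun E _ => E.image e) ?_ ?_ ?_ ?_
  · intro E hE
    rw [Finset.mem_powerset] at hE ⊢
    exact Finset.image_subset_image hE
  · intro E hE E' hE' h
    rw [Finset.mem_powerset] at hE hE'
    have key : ∀ E E' : Finset γ, E ⊆ A → E' ⊆ A → E.image e = E'.image e → E ⊆ E' := by
      intro E E' hE hE' h a ha
      have := Finset.mem_image_of_mem e ha
      rw [h, Finset.mem_image] at this
      obtain ⟨b, hb, hab⟩ := this
      rwa [← he (hE' hb) (hE ha) hab]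
    exact (key E E' hE hE' h).antisymm (key E' E hE' hE h.symm)
  · intro F hF
    rw [Finset.mem_powerset, Finset.subset_image_iff] at hF
    obtain ⟨E, hE, rfl⟩ := hF
    exact ⟨E, Finset.mem_powerset.2 hE, rfl⟩
  · intro E hE
    rw [Finset.card_image_of_injOn (he.mono (Finset.coe_subset.2 (Finset.mem_powerset.1 hE)))]

variable [DecidableEq γ]

theorem wsum_union {w : R} {A B : Finset γ} (hd : Disjoint A B) {f g h : Finset γ → R}
    (hf : ∀ E ⊆ A, ∀ E' ⊆ B, f (E ∪ E') = g E * h E') :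
    wsum w (A ∪ B) f = wsum w A g * wsum w B h := by
  rw [wsum, wsum, wsum, Finset.sum_mul_sum, ← Finset.sum_product']
  symm
  refine Finset.sum_bij' (fun p _ => p.1 ∪ p.2) (fun E _ => (E ∩ A, E ∩ B)) ?_ ?_ ?_ ?_ ?_
  · intro p hp
    rw [Finset.mem_product, Finset.mem_powerset, Finset.mem_powerset] at hp
    exact Finset.mem_powerset.2 (Finset.union_subset_union hp.1 hp.2)
  · intro E _
    simp [Finset.inter_subset_right]
  · intro p hp
    rw [Finset.mem_product, Finset.mem_powerset, Finset.mem_powerset] at hp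
    have h1 : Disjoint p.2 A := (hd.mono_right hp.2).symm
    have h2 : Disjoint p.1 B := hd.mono_left hp.1
    ext1
    · simp only [Finset.union_inter_distrib_right, Finset.inter_eq_left.2 hp.1,
        Finset.disjoint_iff_inter_eq_empty.1 h1, Finset.union_empty]
    · simp only [Finset.union_inter_distrib_right, Finset.inter_eq_left.2 hp.2,
        Finset.disjoint_iff_inter_eq_empty.1 h2, Finset.empty_union]
  · intro E hE
    simp only [← Finset.inter_union_distrib_left,
      Finset.inter_eq_left.2 (Finset.mem_powerset.1 hE)]
  · intro p hp
    rw [Finset.mem_product, Finset.mem_powerset, Finset.mem_powerset] at hp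
    rw [hf _ hp.1 _ hp.2, Finset.card_union_of_disjoint (hd.mono hp.1 hp.2), pow_add]
    ring

/-- The weighted sum of the Möbius functions of the digraphs on `U`. -/
def sigma (w : R) (U : Finset γ) : R :=
  wsum w U.offDiag fun E => (mu (fun a b => (a, b) ∈ E) U : R)

-- Exchange the sums over digraphs and closed sets. For fixed U, arcs entering U are forbidden, arcs
-- inside U contribute `sigma`, and arcs from U to the complement or inside it are free.
open Classical in
theorem sum_sigma (w : R) (V : Finset γ) :
    ∑ U ∈ V.powerset, sigma w U *
      (1 + w) ^ (U.card * (V \ U).card + ((V \ U).card * (V \ U).card - (V \ U).card)) =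
      if V = ∅ then 1 else 0 := by
  have h1 : wsum w V.offDiag (fun E => ∑ U ∈ V.powerset,
      if InClosed (fun a b => (a, b) ∈ E) V U then (mu (fun a b => (a, b) ∈ E) U : R) else 0) =
      if V = ∅ then 1 else 0 := by
    rw [wsum_congr (g := fun _ => if V = ∅ then 1 else 0)]
    · split_ifs with h
      · simp [h, wsum]
      · simp [wsum]
    · intro E _
      rw [← Finset.sum_filter, ← Int.cast_sum]
      have := sum_mu (fun a b => (a, b) ∈ E) V
      rw [closedSets] at this
      rw [this]
      split_ifs <;> simp
  rw [← h1, wsum_sum]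
  refine Finset.sum_congr rfl fun U hU => ?_
  rw [Finset.mem_powerset] at hU
  have hd1 : Disjoint (U ×ˢ (V \ U)) (V \ U).offDiag := by
    refine Finset.disjoint_left.2 fun p hp hp' => ?_
    simp only [Finset.mem_product, Finset.mem_offDiag, Finset.mem_sdiff] at hp hp'
    exact hp'.1.2 hp.1
  have hd2 : Disjoint U.offDiag (U ×ˢ (V \ U) ∪ (V \ U).offDiag) := by
    refine Finset.disjoint_left.2 fun p hp hp' => ?_
    simp only [Finset.mem_union, Finset.mem_product, Finset.mem_offDiag, Finset.mem_sdiff] at hp hp'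
    tauto
  rw [← Finset.offDiag_card, ← Finset.card_product, ← Finset.card_union_of_disjoint hd1,
    ← wsum_one, sigma]
  refine Eq.symm ((wsum_subset (B := U.offDiag ∪ (U ×ˢ (V \ U) ∪ (V \ U).offDiag)) ?_ ?_).trans ?_)
  rotate_left 2
  · refine wsum_union hd2 fun E hE E' hE' => ?_
    rw [mul_one, if_pos]
    · congr 1
      refine mu_congr U fun a ha b hb => ?_
      rw [Finset.mem_union, or_iff_left]
      intro h
      have := hE' h
      simp only [Finset.mem_union, Finset.mem_product, Finset.mem_offDiag, Finset.mem_sdiff] at this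
      tauto
    · refine ⟨hU, fun v hv u hu h => ?_⟩
      rcases Finset.mem_union.1 h with h | h
      · exact (Finset.mem_offDiag.1 (hE h)).1
      · have := hE' h
        simp only [Finset.mem_union, Finset.mem_product, Finset.mem_offDiag,
          Finset.mem_sdiff] at this
        tauto
  · intro p hp
    simp only [Finset.mem_union, Finset.mem_product, Finset.mem_offDiag, Finset.mem_sdiff] at hp ⊢
    have e1 := @hU p.1
    have e2 := @hU p.2
    rcases hp with hp | hp | hp
    · tauto
    · exact ⟨e1 hp.1, hp.2.1, fun h => hp.2.2 (h ▸ hp.1)⟩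
    · tauto
  · intro E hE hnot
    rw [if_neg]
    intro hcl
    refine hnot fun p hp => ?_
    have h1 := Finset.mem_offDiag.1 (hE hp)
    have h2 := hcl.2 p.1 h1.1 p.2
    simp only [Finset.mem_union, Finset.mem_product, Finset.mem_offDiag, Finset.mem_sdiff]
    have h3 : p.2 ∈ U → p.1 ∈ U := fun h => h2 h hp
    tauto

end Weights

/-! ### Two-clauses and implications -/

section Clauses

variable {n : ℕ}

/-- The clauses with two literals, corresponding to distinct variables in `V`. -/
def clauses (V : Finset (Fin n)) : Finset (Clause n) :=
  ((lits V).powersetCard 2).filter fun c => ∀ l ∈ c, ∀ l' ∈ c, l.1 = l'.1 → l = l'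

theorem pair_mem_clauses {V : Finset (Fin n)} {a b : Literal n} :
    ({a, b} : Clause n) ∈ clauses V ↔ a.1 ∈ V ∧ b.1 ∈ V ∧ a.1 ≠ b.1 := by
  rw [clauses, Finset.mem_filter, Finset.mem_powersetCard]
  constructor
  · rintro ⟨⟨h1, h2⟩, h3⟩
    refine ⟨mem_lits.1 (h1 (by simp)), mem_lits.1 (h1 (by simp)), fun h => ?_⟩
    have := h3 a (by simp) b (by simp) h
    simp [this] at h2
  · rintro ⟨ha, hb, hab⟩
    refine ⟨⟨?_, Finset.card_pair fun h => hab (h ▸ rfl)⟩, ?_⟩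
    · intro l hl
      rw [Finset.mem_insert, Finset.mem_singleton] at hl
      rcases hl with rfl | rfl <;> simpa
    · intro l hl l' hl' h
      rw [Finset.mem_insert, Finset.mem_singleton] at hl hl'
      rcases hl with rfl | rfl <;> rcases hl' with rfl | rfl
      · rfl
      · exact absurd h hab
      · exact absurd h.symm hab
      · rfl

theorem mem_clauses {V : Finset (Fin n)} {c : Clause n} :
    c ∈ clauses V ↔ ∃ a b : Literal n, c = {a, b} ∧ a.1 ∈ V ∧ b.1 ∈ V ∧ a.1 ≠ b.1 := by
  constructor
  · intro h
    have h' := h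
    rw [clauses, Finset.mem_filter, Finset.mem_powersetCard] at h'
    obtain ⟨a, b, -, rfl⟩ := Finset.card_eq_two.1 h'.1.2
    exact ⟨a, b, rfl, pair_mem_clauses.1 h⟩
  · rintro ⟨a, b, rfl, h⟩
    exact pair_mem_clauses.2 h

theorem clauses_mono {V W : Finset (Fin n)} (h : V ⊆ W) : clauses V ⊆ clauses W := by
  intro c hc
  obtain ⟨a, b, rfl, ha, hb, hab⟩ := mem_clauses.1 hc
  exact pair_mem_clauses.2 ⟨h ha, h hb, hab⟩

/-- The implications between literals which follow from a clause of `F`. -/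
def implies (F : Formula n) (a b : Literal n) : Prop := ({neg a, b} : Clause n) ∈ F

theorem skew_implies (F : Formula n) : Skew (implies F) := by
  intro a b h
  rw [implies, neg_neg, Finset.pair_comm]
  exact h

theorem exists_respects {F : Formula n} (h : F.Satisfiable) : ∃ x, Respects (implies F) x := by
  obtain ⟨x, hx⟩ := h
  refine ⟨x, fun a b hab ha => ?_⟩
  obtain ⟨l, hl, h⟩ := hx _ hab
  rw [Finset.mem_insert, Finset.mem_singleton] at hl
  rcases hl with rfl | rfl
  · simp [neg, ha] at h
  · exact h

theorem Formula.Satisfiable.mono {F F' : Formula n} (h : F.Satisfiable) (hF : F' ⊆ F) :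
    F'.Satisfiable := by
  obtain ⟨x, hx⟩ := h
  exact ⟨x, fun c hc => hx c (hF hc)⟩

theorem satisfiable_union {F F' : Formula n} {K V : Finset (Fin n)} (hF : F ⊆ clauses K)
    (hF' : F' ⊆ clauses (V \ K)) :
    (F ∪ F').Satisfiable ↔ F.Satisfiable ∧ F'.Satisfiable := by
  refine ⟨fun h => ⟨h.mono Finset.subset_union_left, h.mono Finset.subset_union_right⟩, ?_⟩
  rintro ⟨⟨x, hx⟩, y, hy⟩
  refine ⟨fun i => if i ∈ K then x i else y i, fun c hc => ?_⟩
  rcases Finset.mem_union.1 hc with hc | hc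
  · obtain ⟨l, hl, h⟩ := hx c hc
    obtain ⟨a, b, rfl, ha, hb, hab⟩ := mem_clauses.1 (hF hc)
    refine ⟨l, hl, ?_⟩
    rw [Finset.mem_insert, Finset.mem_singleton] at hl
    rcases hl with rfl | rfl <;> simp [*]
  · obtain ⟨l, hl, h⟩ := hy c hc
    obtain ⟨a, b, rfl, ha, hb, hab⟩ := mem_clauses.1 (hF' hc)
    refine ⟨l, hl, ?_⟩
    rw [Finset.mem_sdiff] at ha hb
    rw [Finset.mem_insert, Finset.mem_singleton] at hl
    rcases hl with rfl | rfl <;> simp [*]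

/-- The implication `a → b` as a clause. -/
def arcClause (p : Literal n × Literal n) : Clause n := {neg p.1, p.2}

/-- The only other arc giving the same clause is the contrapositive, which runs between negated
literals and so is excluded by consistency. -/
theorem arcClause_injOn {U : Finset (Literal n)} (hU : Consistent U) :
    Set.InjOn (arcClause (n := n)) (U ×ˢ U : Finset _) := by
  rintro ⟨a, b⟩ h ⟨a', b'⟩ h' he
  rw [Finset.coe_product, Set.mem_prod] at h h'
  simp only [Finset.mem_coe] at h h'
  simp only [arcClause] at he
  have h1 : b ∈ ({neg a', b'} : Clause n) := by rw [← he]; simp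
  have h2 : neg a ∈ ({neg a', b'} : Clause n) := by rw [← he]; simp
  rw [Finset.mem_insert, Finset.mem_singleton] at h1 h2
  have hb : b = b' := h1.resolve_left fun h3 => hU a' h'.1 (h3 ▸ h.2)
  have ha : neg a = neg a' := h2.resolve_right fun h3 => hU a h.1 (h3 ▸ h'.2)
  have := congrArg neg ha
  rw [neg_neg, neg_neg] at this
  rw [this, hb]

/-- The clauses which correspond to implications inside `U`. -/
def arcClauses (U : Finset (Literal n)) : Finset (Clause n) := U.offDiag.image arcClause

theorem Consistent.eq_of_fst {U : Finset (Literal n)} (hU : Consistent U) {a b : Literal n}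
    (ha : a ∈ U) (hb : b ∈ U) (h : a.1 = b.1) : a = b := by
  rcases eq_or_eq_neg h with h' | h'
  · exact h'
  · exact absurd (h' ▸ ha) (hU b hb)

theorem arcClauses_subset {U : Finset (Literal n)} (hU : Consistent U) {V : Finset (Fin n)}
    (h : U ⊆ lits V) : arcClauses U ⊆ clauses V := by
  intro c hc
  obtain ⟨⟨a, b⟩, hab, rfl⟩ := Finset.mem_image.1 hc
  rw [Finset.mem_offDiag] at hab
  refine pair_mem_clauses.2 ⟨by simpa using h hab.1, mem_lits.1 (h hab.2.1), fun he => ?_⟩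
  exact hab.2.2 (hU.eq_of_fst hab.1 hab.2.1 he)

theorem mu_implies_image {U : Finset (Literal n)} (hU : Consistent U)
    {E : Finset (Literal n × Literal n)} (hE : E ⊆ U.offDiag) :
    mu (implies (E.image arcClause)) U = mu (fun a b => (a, b) ∈ E) U := by
  refine mu_congr U fun a ha b hb => ?_
  have hE' : E ⊆ U ×ˢ U := fun p hp => by
    have := Finset.mem_offDiag.1 (hE hp)
    exact Finset.mem_product.2 ⟨this.1, this.2.1⟩
  constructor
  · intro h
    obtain ⟨p, hp, hpe⟩ := Finset.mem_image.1 h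
    have := arcClause_injOn hU (Finset.mem_coe.2 (hE' hp))
      (Finset.mem_coe.2 (Finset.mk_mem_product ha hb)) hpe
    rwa [← this]
  · exact fun h => Finset.mem_image_of_mem arcClause h

/-! ### Weighted sums over formulas and the square of `tauSum` -/

variable {R : Type*} [CommRing R]

theorem wsum_arcClauses (w : R) {U : Finset (Literal n)} (hU : Consistent U) :
    wsum w (arcClauses U) (fun F => (mu (implies F) U : R)) = sigma w U := by
  rw [arcClauses, wsum_image, sigma]
  · exact wsum_congr fun E hE => by rw [mu_implies_image hU hE]
  · refine (arcClause_injOn hU).mono fun p hp => ?_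
    have := Finset.mem_offDiag.1 (Finset.mem_coe.1 hp)
    exact Finset.mem_coe.2 (Finset.mem_product.2 ⟨this.1, this.2.1⟩)

open Classical in
/-- The weighted number of satisfiable 2-CNFs on the variables in `V`. -/
def satSum (w : R) (V : Finset (Fin n)) : R :=
  wsum w (clauses V) fun F : Formula n => if F.Satisfiable then 1 else 0

open Classical in
/-- The sum of `tau` over the satisfiable 2-CNFs on the variables in `V`. -/
def tauSum (w : R) (V : Finset (Fin n)) : R :=
  wsum w (clauses V) fun F : Formula n => if F.Satisfiable then (tau (implies F) V : R) else 0

theorem noArcs_of_subset_union {F : Formula n} {K V : Finset (Fin n)}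
    (hF : F ⊆ clauses K ∪ clauses (V \ K)) : NoArcs (implies F) (lits K) (lits (V \ K)) := by
  have key : ∀ a b : Literal n, a.1 ∈ K → b.1 ∈ V \ K → ({a, b} : Clause n) ∉ F := by
    intro a b ha hb h
    rcases Finset.mem_union.1 (hF h) with h | h
    · exact (Finset.mem_sdiff.1 hb).2 (pair_mem_clauses.1 h).2.1
    · exact (Finset.mem_sdiff.1 (pair_mem_clauses.1 h).1).2 ha
  intro a ha b hb
  rw [mem_lits] at ha hb
  refine ⟨key (neg a) b ha hb, fun h => ?_⟩
  rw [implies, Finset.pair_comm] at h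
  exact key a (neg b) ha hb h

theorem subset_union_of_noArcs {F : Formula n} {K V : Finset (Fin n)} (hF : F ⊆ clauses V)
    (h : NoArcs (implies F) (lits K) (lits (V \ K))) : F ⊆ clauses K ∪ clauses (V \ K) := by
  intro c hc
  obtain ⟨a, b, rfl, ha, hb, hab⟩ := mem_clauses.1 (hF hc)
  rw [Finset.mem_union, pair_mem_clauses, pair_mem_clauses, Finset.mem_sdiff, Finset.mem_sdiff]
  by_cases ha' : a.1 ∈ K <;> by_cases hb' : b.1 ∈ K
  · exact Or.inl ⟨ha', hb', hab⟩
  · refine absurd ?_ (h (neg a) (by simpa using ha') b (by simp [hb, hb'])).1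
    rwa [implies, neg_neg]
  · refine absurd ?_ (h b (by simpa using hb') (neg a) (by simp [ha, ha'])).2
    rwa [implies, neg_neg]
  · exact Or.inr ⟨⟨ha, ha'⟩, ⟨hb, hb'⟩, hab⟩

-- A formula on V with no arcs across K is the same as independent formulas on K and V \ K, and
-- satisfiability and `tau` are determined part by part.
open Classical in
theorem tauSum_mul_tauSum (w : R) {K V : Finset (Fin n)} (hK : K ⊆ V) :
    tauSum w K * tauSum w (V \ K) = wsum w (clauses V) fun F : Formula n =>
      if F.Satisfiable then
        if NoArcs (implies F) (lits K) (lits (V \ K)) then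
          ((tau (implies F) K * tau (implies F) (V \ K) : ℤ) : R) else 0
      else 0 := by
  have hd : Disjoint (clauses K) (clauses (V \ K)) := by
    refine Finset.disjoint_left.2 fun c hc hc' => ?_
    obtain ⟨a, b, rfl, ha, hb, hab⟩ := mem_clauses.1 hc
    exact (Finset.mem_sdiff.1 (pair_mem_clauses.1 hc').1).2 ha
  refine Eq.symm ((wsum_subset (B := clauses K ∪ clauses (V \ K)) ?_ ?_).trans ?_)
  · exact Finset.union_subset (clauses_mono hK) (clauses_mono Finset.sdiff_subset)
  · intro F hF hn
    rw [if_neg fun h => hn (subset_union_of_noArcs hF h), ite_self]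
  · refine wsum_union hd fun F hF F' hF' => ?_
    rw [if_pos (noArcs_of_subset_union (Finset.union_subset_union hF hF')),
      satisfiable_union hF hF']
    have e1 : tau (implies (F ∪ F')) K = tau (implies F) K := by
      refine tau_congr fun a ha b hb => ?_
      rw [implies, Finset.mem_union, or_iff_left]
      · rfl
      · intro h
        rw [mem_lits] at ha
        exact (Finset.mem_sdiff.1 (pair_mem_clauses.1 (hF' h)).1).2 ha
    have e2 : tau (implies (F ∪ F')) (V \ K) = tau (implies F') (V \ K) := by
      refine tau_congr fun a ha b hb => ?_
      rw [implies, Finset.mem_union, or_iff_right]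
      · rfl
      · intro h
        rw [mem_lits] at ha
        exact (Finset.mem_sdiff.1 ha).2 (pair_mem_clauses.1 (hF h)).1
    rw [e1, e2]
    by_cases h1 : Formula.Satisfiable F <;> by_cases h2 : Formula.Satisfiable F' <;> simp [h1, h2]

/-- The assignment making the negations of the literals of `U` true, and equal to `x` on the
other variables. -/
def extend (U : Finset (Literal n)) (x : Fin n → Bool) (i : Fin n) : Bool :=
  if (i, true) ∈ U then false else if (i, false) ∈ U then true else x i

theorem extend_eq {U : Finset (Literal n)} (hU : Consistent U) (x : Fin n → Bool)
    {a : Literal n} (ha : a ∈ negSet U) : extend U x a.1 = a.2 := by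
  rw [mem_negSet] at ha
  have := hU _ ha
  obtain ⟨i, s⟩ := a
  cases s <;> simp_all [neg, extend]

theorem extend_of_notMem {U : Finset (Literal n)} (x : Fin n → Bool)
    {i : Fin n} (hi : i ∉ vars U) : extend U x i = x i := by
  have h1 : (i, true) ∉ U := fun h => hi (mem_vars.2 ⟨_, h, rfl⟩)
  have h2 : (i, false) ∉ U := fun h => hi (mem_vars.2 ⟨_, h, rfl⟩)
  simp [extend, h1, h2]

theorem satisfiable_of_subset_arcClauses {U : Finset (Literal n)} (hU : Consistent U)
    {F : Formula n} (hF : F ⊆ arcClauses U) : F.Satisfiable := by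
  refine ⟨extend U fun _ => true, fun c hc => ?_⟩
  obtain ⟨⟨a, b⟩, hab, rfl⟩ := Finset.mem_image.1 (hF hc)
  rw [Finset.mem_offDiag] at hab
  exact ⟨neg a, by simp [arcClause], extend_eq hU _ (by simpa using hab.1)⟩

/-- Separation means that each clause has one literal in U and one in its negation, which is an
implication inside U. -/
theorem separating_implies_iff {F : Formula n} {V : Finset (Fin n)} (hF : F ⊆ clauses V)
    {U : Finset (Literal n)} (hUV : U ⊆ lits V) :
    Separating (implies F) V U ↔ (Consistent U ∧ vars U = V) ∧ F ⊆ arcClauses U := by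
  rw [separating_iff]
  constructor
  · rintro ⟨-, h1, h2⟩
    refine ⟨⟨fun a ha => (h1 a (hUV ha)).1 ha, ?_⟩, fun c hc => ?_⟩
    · ext i
      have := h1 (i, true)
      rw [mem_lits] at this
      have h3 := fst_mem_vars (U := U) (a := (i, true))
      have h4 := @hUV (i, true)
      have h5 := @hUV (neg (i, true))
      rw [mem_lits] at h4 h5
      simp only [neg_fst] at *
      tauto
    · obtain ⟨a, b, rfl, ha, hb, hab⟩ := mem_clauses.1 (hF hc)
      rw [arcClauses, Finset.mem_image]
      have e1 := h1 a (mem_lits.2 ha)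
      have e2 := h1 b (mem_lits.2 hb)
      have e3 := h2 (neg a) (by simpa using ha) b (by simpa using hb) (by rwa [implies, neg_neg])
      -- This decides which of the two contrapositive arcs of the clause lies inside U.
      by_cases h : b ∈ U
      · refine ⟨(neg a, b), Finset.mem_offDiag.2 ⟨e3.2 h, h, fun h' => hab ?_⟩, ?_⟩
        · exact show (neg a).1 = b.1 from congrArg Prod.fst (show neg a = b from h')
        · simp [arcClause]
      · refine ⟨(neg b, a), Finset.mem_offDiag.2 ⟨by tauto, by tauto, fun h' => hab ?_⟩, ?_⟩
        · exact (show (neg b).1 = a.1 from congrArg Prod.fst (show neg b = a from h')).symm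
        · simp [arcClause, Finset.pair_comm]
  · rintro ⟨⟨h1, h2⟩, h3⟩
    refine ⟨hUV, fun a ha => ?_, fun a ha b hb hab => ?_⟩
    · rw [mem_lits, ← h2, fst_mem_vars] at ha
      have := h1 a
      tauto
    · have hc := h3 hab
      rw [arcClauses, Finset.mem_image] at hc
      obtain ⟨⟨p, q⟩, hpq, he⟩ := hc
      rw [Finset.mem_offDiag] at hpq
      simp only [arcClause] at he hpq
      have e1 : neg a ∈ ({neg p, q} : Clause n) := by rw [he]; simp
      have e2 : b ∈ ({neg p, q} : Clause n) := by rw [he]; simp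
      have hne : neg a ≠ b := fun h => (pair_mem_clauses.1 (hF hab)).2.2 (h ▸ rfl)
      rw [Finset.mem_insert, Finset.mem_singleton] at e1 e2
      have hp := h1 p hpq.1
      have hq := h1 q hpq.2.1
      rcases e1 with e1 | e1 <;> rcases e2 with e2 | e2
      · exact absurd (e1.trans e2.symm) hne
      · have : a = p := by simpa using congrArg neg e1
        rw [this, e2]
        tauto
      · have : a = neg q := by simpa using congrArg neg e1
        rw [this, e2]
        tauto
      · exact absurd (e1.trans e2.symm) hne

-- Apply `sum_tau_mul_tau` formula by formula, then sum over formulas first: those separated by U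
-- are the digraphs on U.
open Classical in
theorem sum_tauSum_mul_tauSum (w : R) (V : Finset (Fin n)) :
    ∑ K ∈ V.powerset, tauSum w K * tauSum w (V \ K) =
      ∑ U ∈ (lits V).powerset with (Consistent U ∧ vars U = V), sigma w U := by
  rw [Finset.sum_congr rfl fun K hK => tauSum_mul_tauSum w (Finset.mem_powerset.1 hK), ← wsum_sum]
  have h1 : ∀ F : Formula n, F ⊆ clauses V → (∑ K ∈ V.powerset, if F.Satisfiable then
        if NoArcs (implies F) (lits K) (lits (V \ K)) then
          ((tau (implies F) K * tau (implies F) (V \ K) : ℤ) : R) else 0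
      else 0) = ∑ U ∈ (lits V).powerset with (Consistent U ∧ vars U = V),
        if F ⊆ arcClauses U then (mu (implies F) U : R) else 0 := by
    intro F hF
    have h2 : (∑ U ∈ (lits V).powerset with (Consistent U ∧ vars U = V),
        if F ⊆ arcClauses U then (mu (implies F) U : R) else 0) =
        ∑ U ∈ (lits V).powerset with Separating (implies F) V U, (mu (implies F) U : R) := by
      rw [← Finset.sum_filter, Finset.filter_filter]
      refine Finset.sum_congr (Finset.filter_congr fun U hU => ?_) fun _ _ => rfl
      rw [separating_implies_iff hF (Finset.mem_powerset.1 hU)]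
    rw [h2]
    by_cases hs : F.Satisfiable
    · simp only [if_pos hs]
      obtain ⟨x, hx⟩ := exists_respects hs
      rw [← Finset.sum_filter, ← Int.cast_sum, sum_tau_mul_tau (skew_implies F) hx V, Int.cast_sum]
    -- Restricting to satisfiable formulas loses nothing on the right: falsifying U satisfies any
    -- formula that U separates.
    · simp only [if_neg hs, Finset.sum_const_zero]
      refine (Finset.sum_eq_zero fun U hU => ?_).symm
      rw [Finset.mem_filter, Finset.mem_powerset] at hU
      have := (separating_implies_iff hF hU.1).1 hU.2
      exact absurd (satisfiable_of_subset_arcClauses this.1.1 this.2) hs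
  rw [wsum_congr h1, wsum_sum]
  refine Finset.sum_congr rfl fun U hU => ?_
  rw [Finset.mem_filter, Finset.mem_powerset] at hU
  rw [← wsum_arcClauses w hU.2.1, wsum_subset (arcClauses_subset hU.2.1 hU.1)]
  · exact wsum_congr fun F hF => if_pos hF
  · exact fun F _ hF => if_neg hF

end Clauses

/-! ### Decomposition of a formula along a consistent closed set -/

section Decomposition

variable {n : ℕ}

open Classical in
/-- The clauses on `V` which contain the negation of a literal of `U`, but no literal of `U`. -/
def freeClauses (V : Finset (Fin n)) (U : Finset (Literal n)) : Finset (Clause n) :=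
  (clauses V).filter fun c => (∀ l ∈ c, l ∉ U) ∧ ∃ l ∈ c, neg l ∈ U

theorem pair_mem_freeClauses {V : Finset (Fin n)} {U : Finset (Literal n)} {a b : Literal n} :
    ({a, b} : Clause n) ∈ freeClauses V U ↔
      ({a, b} : Clause n) ∈ clauses V ∧ (a ∉ U ∧ b ∉ U) ∧ (neg a ∈ U ∨ neg b ∈ U) := by
  simp only [freeClauses, Finset.mem_filter, Finset.mem_insert, Finset.mem_singleton,
    forall_eq_or_imp, forall_eq, exists_eq_or_imp, exists_eq_left]

theorem pair_mem_arcClauses {U : Finset (Literal n)} {a b : Literal n} :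
    ({a, b} : Clause n) ∈ arcClauses U ↔
      (neg a ∈ U ∧ b ∈ U ∨ neg b ∈ U ∧ a ∈ U) ∧ neg a ≠ b := by
  rw [arcClauses, Finset.mem_image]
  constructor
  · rintro ⟨⟨p, q⟩, hpq, he⟩
    rw [Finset.mem_offDiag] at hpq
    obtain ⟨hp, hq, hne⟩ := hpq
    simp only [arcClause] at he hp hq hne
    have e1 : a ∈ ({neg p, q} : Clause n) := by rw [he]; simp
    have e2 : b ∈ ({neg p, q} : Clause n) := by rw [he]; simp
    have e3 : neg p ∈ ({a, b} : Clause n) := by rw [← he]; simp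
    have e4 : q ∈ ({a, b} : Clause n) := by rw [← he]; simp
    rw [Finset.mem_insert, Finset.mem_singleton] at e1 e2 e3 e4
    rcases e1 with rfl | rfl
    · rw [neg_neg]
      rcases e4 with rfl | rfl
      · obtain rfl : b = neg p := by simpa using e2
        simp only [neg_neg]
        exact ⟨Or.inl ⟨hp, hq⟩, hne⟩
      · exact ⟨Or.inl ⟨hp, hq⟩, hne⟩
    · rcases e3 with h | rfl
      · rcases e2 with rfl | rfl
        all_goals
          rw [← h]
          simp only [neg_neg]
          exact ⟨Or.inl ⟨hp, by rw [h]; exact hq⟩, by rw [h]; exact hne⟩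
      · simp only [neg_neg]
        exact ⟨Or.inr ⟨hp, hq⟩, fun h' => hne (by simpa using (congrArg neg h').symm)⟩
  · rintro ⟨⟨h1, h2⟩ | ⟨h1, h2⟩, hne⟩
    · exact ⟨(neg a, b), Finset.mem_offDiag.2 ⟨h1, h2, hne⟩, by simp [arcClause]⟩
    · refine ⟨(neg b, a), Finset.mem_offDiag.2 ⟨h1, h2, fun h => hne ?_⟩, ?_⟩
      · simp only at h
        rw [← h, neg_neg]
      · simp [arcClause, Finset.pair_comm]

theorem pair_mem_clauses_sdiff {V : Finset (Fin n)} {U : Finset (Literal n)} {a b : Literal n} :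
    ({a, b} : Clause n) ∈ clauses (V \ vars U) ↔
      ({a, b} : Clause n) ∈ clauses V ∧ (a ∉ U ∧ neg a ∉ U) ∧ (b ∉ U ∧ neg b ∉ U) := by
  rw [pair_mem_clauses, pair_mem_clauses, Finset.mem_sdiff, Finset.mem_sdiff, fst_mem_vars,
    fst_mem_vars]
  tauto

/-- Closedness says that a clause containing a literal of U has the negation of its other literal in
U. All other clauses avoid U, and either touch its negation or avoid its variables. -/
theorem inClosed_implies_iff {F : Formula n} {V : Finset (Fin n)} (hF : F ⊆ clauses V)
    {U : Finset (Literal n)} (hU : Consistent U) (hUV : U ⊆ lits V) :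
    InClosed (implies F) (lits V) U ↔
      F ⊆ (arcClauses U ∪ freeClauses V U) ∪ clauses (V \ vars U) := by
  constructor
  · intro h c hc
    obtain ⟨a, b, rfl, ha, hb, hab⟩ := mem_clauses.1 (hF hc)
    have e1 : a ∈ U → neg b ∈ U := fun h' => h.2 (neg b) (by simpa using hb) a h' (by
      rwa [implies, neg_neg, Finset.pair_comm])
    have e2 : b ∈ U → neg a ∈ U := fun h' => h.2 (neg a) (by simpa using ha) b h' (by
      rwa [implies, neg_neg])
    have hne : neg a ≠ b := fun h => hab (by rw [← h, neg_fst])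
    rw [Finset.mem_union, Finset.mem_union, pair_mem_arcClauses, pair_mem_freeClauses,
      pair_mem_clauses_sdiff]
    have := hF hc
    tauto
  · intro h
    refine ⟨hUV, fun v hv u hu hvu => ?_⟩
    have := h hvu
    rw [Finset.mem_union, Finset.mem_union, pair_mem_arcClauses, pair_mem_freeClauses,
      pair_mem_clauses_sdiff] at this
    have h1 := hU u hu
    simp only [neg_neg] at this
    tauto

theorem disjoint_arcClauses_freeClauses (V : Finset (Fin n)) (U : Finset (Literal n)) :
    Disjoint (arcClauses U) (freeClauses V U) := by
  refine Finset.disjoint_left.2 fun c hc hc' => ?_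
  obtain ⟨a, b, rfl, -⟩ := mem_clauses.1 (Finset.mem_filter.1 hc').1
  rw [pair_mem_arcClauses] at hc
  rw [pair_mem_freeClauses] at hc'
  tauto

theorem disjoint_clauses_sdiff_vars (V : Finset (Fin n)) (U : Finset (Literal n)) :
    Disjoint (arcClauses U ∪ freeClauses V U) (clauses (V \ vars U)) := by
  refine Finset.disjoint_left.2 fun c hc hc' => ?_
  obtain ⟨a, b, rfl, -⟩ := mem_clauses.1 hc'
  rw [Finset.mem_union, pair_mem_arcClauses, pair_mem_freeClauses] at hc
  rw [pair_mem_clauses_sdiff] at hc'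
  tauto

/-- Making all literals of U false satisfies the clauses of F without constraining the variables
outside U. -/
theorem satisfiable_union_iff {F F' : Formula n} {V : Finset (Fin n)} {U : Finset (Literal n)}
    (hU : Consistent U) (hF : F ⊆ arcClauses U ∪ freeClauses V U)
    (hF' : F' ⊆ clauses (V \ vars U)) : (F ∪ F').Satisfiable ↔ F'.Satisfiable := by
  refine ⟨fun h => h.mono Finset.subset_union_right, ?_⟩
  rintro ⟨x, hx⟩
  refine ⟨extend U x, fun c hc => ?_⟩
  rcases Finset.mem_union.1 hc with hc | hc
  · rcases Finset.mem_union.1 (hF hc) with hc | hc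
    · obtain ⟨⟨a, b⟩, hab, rfl⟩ := Finset.mem_image.1 hc
      rw [Finset.mem_offDiag] at hab
      exact ⟨neg a, by simp [arcClause], extend_eq hU _ (by simpa using hab.1)⟩
    · obtain ⟨l, hl, hn⟩ := (Finset.mem_filter.1 hc).2.2
      exact ⟨l, hl, extend_eq hU _ (mem_negSet.2 hn)⟩
  · obtain ⟨l, hl, h⟩ := hx c hc
    refine ⟨l, hl, ?_⟩
    rw [extend_of_notMem, h]
    obtain ⟨a, b, rfl, ha, hb, hab⟩ := mem_clauses.1 (hF' hc)
    rw [Finset.mem_insert, Finset.mem_singleton] at hl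
    rw [Finset.mem_sdiff] at ha hb
    rcases hl with rfl | rfl
    · exact ha.2
    · exact hb.2

theorem freeClauses_eq {V : Finset (Fin n)} {U : Finset (Literal n)} (hU : Consistent U)
    (hUV : U ⊆ lits V) :
    freeClauses V U = (negSet U).powersetCard 2 ∪
      (negSet U ×ˢ lits (V \ vars U)).image fun p => {p.1, p.2} := by
  ext c
  rw [Finset.mem_union, Finset.mem_powersetCard, Finset.mem_image]
  constructor
  · intro hc
    obtain ⟨a, b, rfl, ha, hb, hab⟩ := mem_clauses.1 (Finset.mem_filter.1 hc).1
    rw [pair_mem_freeClauses] at hc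
    obtain ⟨hc, ⟨h1, h2⟩, h3⟩ := hc
    by_cases ha' : neg a ∈ U <;> by_cases hb' : neg b ∈ U
    · refine Or.inl ⟨?_, Finset.card_pair fun h => hab (h ▸ rfl)⟩
      intro l hl
      rw [Finset.mem_insert, Finset.mem_singleton] at hl
      rcases hl with rfl | rfl <;> rwa [mem_negSet]
    · refine Or.inr ⟨(a, b), Finset.mk_mem_product (mem_negSet.2 ha') ?_, rfl⟩
      rw [mem_lits, Finset.mem_sdiff, fst_mem_vars]
      tauto
    · refine Or.inr ⟨(b, a), Finset.mk_mem_product (mem_negSet.2 hb') ?_, Finset.pair_comm _ _⟩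
      rw [mem_lits, Finset.mem_sdiff, fst_mem_vars]
      tauto
    · tauto
  · rintro (⟨h1, h2⟩ | ⟨⟨a, b⟩, hab, rfl⟩)
    · obtain ⟨a, b, hab, rfl⟩ := Finset.card_eq_two.1 h2
      have ha : a ∈ negSet U := h1 (by simp)
      have hb : b ∈ negSet U := h1 (by simp)
      have ha' := negSet_subset_lits hUV ha
      have hb' := negSet_subset_lits hUV hb
      rw [mem_lits] at ha' hb'
      rw [pair_mem_freeClauses, pair_mem_clauses]
      refine ⟨⟨ha', hb', fun h => hab (hU.negSet.eq_of_fst ha hb h)⟩, ⟨fun h => ?_, fun h => ?_⟩,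
        Or.inl (mem_negSet.1 ha)⟩
      · exact hU _ h (mem_negSet.1 ha)
      · exact hU _ h (mem_negSet.1 hb)
    · rw [Finset.mem_product, mem_lits, Finset.mem_sdiff, fst_mem_vars, mem_negSet] at hab
      simp only at hab
      rw [pair_mem_freeClauses, pair_mem_clauses]
      have h1 := hUV hab.1
      rw [mem_lits, neg_fst] at h1
      refine ⟨⟨h1, hab.2.1, fun h => hab.2.2 ?_⟩, ⟨fun h => hU _ h hab.1, by tauto⟩,
        Or.inl hab.1⟩
      rw [← fst_mem_vars, ← h, fst_mem_vars]
      exact Or.inr hab.1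

/-- Either both literals lie in the negation of U, or one does and the other is one of the two
literals of an outside variable. -/
theorem card_freeClauses {V : Finset (Fin n)} {U : Finset (Literal n)} (hU : Consistent U)
    (hUV : U ⊆ lits V) :
    (freeClauses V U).card = U.card.choose 2 + U.card * ((V \ vars U).card * 2) := by
  have hneg : (negSet U).card = U.card := Finset.card_image_of_injective _ fun a b h => by
    simpa using congrArg neg h
  have hout : ∀ a b : Literal n, a ∈ negSet U → b ∈ lits (V \ vars U) → b ∉ negSet U := by
    intro a b ha hb h
    rw [mem_lits, Finset.mem_sdiff, fst_mem_vars] at hb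
    rw [mem_negSet] at h
    tauto
  rw [freeClauses_eq hU hUV, Finset.card_union_of_disjoint, Finset.card_powersetCard,
    Finset.card_image_of_injOn, Finset.card_product, hneg, lits, Finset.card_product,
    Finset.card_univ, Fintype.card_bool]
  · rintro ⟨a, b⟩ h ⟨a', b'⟩ h' he
    rw [Finset.mem_coe, Finset.mem_product] at h h'
    simp only at h h' he
    have e1 : a ∈ ({a', b'} : Clause n) := by rw [← he]; simp
    have e2 : b ∈ ({a', b'} : Clause n) := by rw [← he]; simp
    rw [Finset.mem_insert, Finset.mem_singleton] at e1 e2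
    have f1 : a = a' := e1.resolve_right fun h3 => hout a b' h.1 h'.2 (h3 ▸ h.1)
    have f2 : b = b' := e2.resolve_left fun h3 => hout a b h.1 h.2 (h3 ▸ h'.1)
    rw [f1, f2]
  · refine Finset.disjoint_left.2 fun c hc hc' => ?_
    obtain ⟨⟨a, b⟩, hab, rfl⟩ := Finset.mem_image.1 hc'
    rw [Finset.mem_product] at hab
    exact hout a b hab.1 hab.2 ((Finset.mem_powersetCard.1 hc).1 (by simp))

variable {R : Type*} [CommRing R]

-- The three blocks of clauses are chosen independently: `mu` depends only on the first,
-- satisfiability only on the last, and the free block contributes a power of 1 + w.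
open Classical in
theorem wsum_inClosed (w : R) {V : Finset (Fin n)} {U : Finset (Literal n)} (hU : Consistent U)
    (hUV : U ⊆ lits V) :
    (wsum w (clauses V) fun F : Formula n => if F.Satisfiable then
      if InClosed (implies F) (lits V) U then (mu (implies F) U : R) else 0 else 0) =
      sigma w U * (1 + w) ^ (U.card.choose 2 + U.card * ((V \ vars U).card * 2)) *
        satSum w (V \ vars U) := by
  have hsub : arcClauses U ∪ freeClauses V U ∪ clauses (V \ vars U) ⊆ clauses V :=
    Finset.union_subset (Finset.union_subset (arcClauses_subset hU hUV)
      (Finset.filter_subset _ _)) (clauses_mono Finset.sdiff_subset)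
  -- The head of an implication is a literal of its clause, so clauses avoiding U create no arcs
  -- inside U.
  have hcongr : ∀ F F' : Formula n, (∀ c ∈ F', ∀ u ∈ U, u ∉ c) →
      mu (implies (F ∪ F')) U = mu (implies F) U := by
    intro F F' h
    refine mu_congr U fun a ha b hb => ?_
    rw [implies, Finset.mem_union, or_iff_left]
    · rfl
    · exact fun hF => h _ hF b hb (by simp)
  rw [← card_freeClauses hU hUV, ← wsum_one, ← wsum_arcClauses w hU]
  refine (wsum_subset hsub ?_).trans ?_
  · intro F hF hn
    rw [if_neg fun h => hn ((inClosed_implies_iff hF hU hUV).1 h), ite_self]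
  rw [← wsum_union (f := fun F => (mu (implies F) U : R))
    (disjoint_arcClauses_freeClauses V U) fun F hF F' hF' => ?_]
  · refine wsum_union (disjoint_clauses_sdiff_vars V U) fun F hF F' hF' => ?_
    have h := Finset.union_subset_union hF hF'
    rw [if_pos ((inClosed_implies_iff (h.trans hsub) hU hUV).2 h),
      satisfiable_union_iff hU hF hF', hcongr, mul_ite, mul_one, mul_zero]
    intro c hc u hu huc
    obtain ⟨a, b, rfl, ha, hb, -⟩ := mem_clauses.1 (hF' hc)
    rw [Finset.mem_sdiff, fst_mem_vars] at ha hb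
    rw [Finset.mem_insert, Finset.mem_singleton] at huc
    rcases huc with rfl | rfl <;> tauto
  · rw [mul_one, hcongr]
    intro c hc u hu huc
    exact (Finset.mem_filter.1 (hF' hc)).2.1 u huc hu

open Classical in
theorem tauSum_eq_sum (w : R) (V : Finset (Fin n)) :
    tauSum w V = ∑ U ∈ (lits V).powerset with Consistent U,
      sigma w U * (1 + w) ^ (U.card.choose 2 + U.card * ((V \ vars U).card * 2)) *
        satSum w (V \ vars U) := by
  rw [tauSum, wsum_congr (g := fun F : Formula n => ∑ U ∈ (lits V).powerset with Consistent U,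
    if F.Satisfiable then
      if InClosed (implies F) (lits V) U then (mu (implies F) U : R) else 0 else 0), wsum_sum]
  · refine Finset.sum_congr rfl fun U hU => ?_
    rw [Finset.mem_filter, Finset.mem_powerset] at hU
    exact wsum_inClosed w hU.2 hU.1
  · intro F _
    split_ifs
    · rw [← Finset.sum_filter, Finset.filter_filter, tau, consistentClosedSets, closedSets,
        Finset.filter_filter, Int.cast_sum]
      simp only [and_comm]
    · simp

end Decomposition

/-! ### Exponential generating functions -/

section Egf

theorem egfCoeff_egf (a : ℕ → ℚ⟦X⟧) (n : ℕ) : egfCoeff (egf a) n = a n := by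
  rw [egfCoeff, egf, PowerSeries.coeff_mk, smul_smul, mul_one_div_cancel, one_smul]
  exact_mod_cast n.factorial_ne_zero

theorem egfCoeff_mul (f g : BiSeries) (n : ℕ) :
    egfCoeff (f * g) n =
      ∑ k ∈ Finset.range (n + 1), n.choose k • (egfCoeff f k * egfCoeff g (n - k)) := by
  rw [egfCoeff, PowerSeries.coeff_mul, Finset.Nat.sum_antidiagonal_eq_sum_range_succ_mk,
    Finset.smul_sum]
  refine Finset.sum_congr rfl fun k hk => ?_
  rw [egfCoeff, egfCoeff, smul_mul_smul_comm, ← Nat.cast_smul_eq_nsmul ℚ, smul_smul]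
  congr 1
  rw [← Nat.choose_mul_factorial_mul_factorial (Nat.lt_succ_iff.1 (Finset.mem_range.1 hk))]
  push_cast
  ring

theorem sum_egfCoeff_mul {γ : Type*} [DecidableEq γ] (f g : BiSeries) (V : Finset γ) :
    ∑ K ∈ V.powerset, egfCoeff f K.card * egfCoeff g (V \ K).card =
      egfCoeff (f * g) V.card := by
  rw [egfCoeff_mul, ← Finset.sum_powerset_apply_card
    (fun k => egfCoeff f k * egfCoeff g (V.card - k))]
  refine Finset.sum_congr rfl fun K hK => ?_
  rw [Finset.card_sdiff_of_subset (Finset.mem_powerset.1 hK)]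

theorem egfCoeff_rescale (c : ℚ⟦X⟧) (f : BiSeries) (n : ℕ) :
    egfCoeff (PowerSeries.rescale c f) n = c ^ n * egfCoeff f n := by
  rw [egfCoeff, egfCoeff, PowerSeries.coeff_rescale, mul_smul_comm]

theorem egfCoeff_one (n : ℕ) : egfCoeff 1 n = if n = 0 then 1 else 0 := by
  rw [egfCoeff, PowerSeries.coeff_one]
  split_ifs with h
  · simp [h]
  · simp

theorem egfCoeff_zero (f : BiSeries) : egfCoeff f 0 = PowerSeries.constantCoeff f := by
  simp [egfCoeff]

end Egf

theorem choose_two_add (j k : ℕ) :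
    (j + k).choose 2 = j.choose 2 + k.choose 2 + j * k := by
  induction k with
  | zero => simp
  | succ k ih =>
    rw [← add_assoc, Nat.choose_succ_succ' (j + k) 1, Nat.choose_succ_succ' k 1, ih,
      Nat.choose_one_right, Nat.choose_one_right]
    ring

theorem mul_self_eq (k : ℕ) : k * k = 2 * k.choose 2 + k := by
  induction k with
  | zero => simp
  | succ k ih =>
    rw [Nat.choose_succ_succ' k 1, Nat.choose_one_right]
    linarith

theorem mul_self_sub (k : ℕ) : k * k - k = 2 * k.choose 2 := by
  rw [mul_self_eq, Nat.add_sub_cancel]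

theorem card_add_card_sdiff {γ : Type*} [DecidableEq γ] {U V : Finset γ} (h : U ⊆ V) :
    U.card + (V \ U).card = V.card := by
  rw [add_comm, Finset.card_sdiff_add_card_eq_card h]

/-! ### Solving the recursions with generating functions -/

section Solution

theorem egfCoeff_graphGF (n : ℕ) :
    egfCoeff graphGF n = (1 + PowerSeries.X) ^ n.choose 2 := by
  rw [graphGF, egfCoeff_egf, Units.val_pow_eq_pow_val]
  rfl

/-- The series `G ⊙ 1 / G`. -/
abbrev hadamardInverse : BiSeries := hadamard graphGF (inverse graphGF)

theorem egfCoeff_hadamardInverse (n : ℕ) : egfCoeff hadamardInverse n =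
    (1 + PowerSeries.X) ^ n.choose 2 * egfCoeff (inverse graphGF) n := by
  rw [hadamardInverse, hadamard, egfCoeff_egf, egfCoeff_graphGF]

/-- After division by (1+w)^(n choose 2), `sum_sigma` becomes a convolution with the coefficients of
G equal to 1; strong induction replaces explicit inversion. -/
theorem sigma_eq {γ : Type*} [DecidableEq γ] (V : Finset γ) :
    sigma (PowerSeries.X : ℚ⟦X⟧) V = egfCoeff hadamardInverse V.card := by
  induction V using Finset.strongInduction with
  | H V ih =>
    have h1 := sum_sigma (PowerSeries.X : ℚ⟦X⟧) V
    have h2 : ∑ U ∈ V.powerset, egfCoeff hadamardInverse U.card * (1 + PowerSeries.X) ^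
        (U.card * (V \ U).card + ((V \ U).card * (V \ U).card - (V \ U).card)) =
        if V = ∅ then 1 else 0 := by
      have h3 := sum_egfCoeff_mul (inverse graphGF) graphGF V
      rw [mul_comm, mul_inverse _ constantCoeff_graphGF, egfCoeff_one] at h3
      have h4 : (if V = ∅ then 1 else 0 : ℚ⟦X⟧) =
          (1 + PowerSeries.X) ^ V.card.choose 2 * if V.card = 0 then 1 else 0 := by
        by_cases h : V = ∅ <;> simp [h]
      rw [h4, ← h3, Finset.mul_sum]
      refine Finset.sum_congr rfl fun U hU => ?_
      rw [← card_add_card_sdiff (Finset.mem_powerset.1 hU), choose_two_add, mul_self_sub,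
        egfCoeff_hadamardInverse, egfCoeff_graphGF]
      ring
    rw [← h2, ← sub_eq_zero, ← Finset.sum_sub_distrib,
      Finset.sum_eq_single_of_mem V (Finset.mem_powerset_self V)] at h1
    · simpa [sub_eq_zero] using h1
    · intro U hU hne
      rw [ih U ((Finset.mem_powerset.1 hU).ssubset_of_ne hne), sub_self]

variable {n : ℕ}

theorem clauses_empty : clauses (∅ : Finset (Fin n)) = ∅ := by
  refine Finset.eq_empty_of_forall_notMem fun c hc => ?_
  obtain ⟨a, b, -, ha, -⟩ := mem_clauses.1 hc
  exact absurd ha (Finset.notMem_empty _)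

theorem satisfiable_empty : Formula.Satisfiable (∅ : Formula n) :=
  ⟨fun _ => true, fun _ hc => absurd hc (Finset.notMem_empty _)⟩

theorem tauSum_empty {R : Type*} [CommRing R] (w : R) :
    tauSum w (∅ : Finset (Fin n)) = 1 := by
  simp [tauSum, clauses_empty, wsum, satisfiable_empty, tau_empty]

/-- The square root of `G ⊙ 1 / G`. -/
abbrev rootSeries : BiSeries := squareRoot hadamardInverse

/-- A series with constant coefficient 1 is determined by its square. The factor 2^n counts the
choices of one literal per variable. -/
theorem tauSum_eq (V : Finset (Fin n)) :
    tauSum (PowerSeries.X : ℚ⟦X⟧) V = 2 ^ V.card * egfCoeff rootSeries V.card := by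
  classical
  induction V using Finset.strongInduction with
  | H V ih =>
    rcases V.eq_empty_or_nonempty with rfl | hV
    · rw [tauSum_empty, Finset.card_empty, egfCoeff_zero,
        constantCoeff_squareRoot _ constantCoeff_hadamard_graphGF_inverse]
      simp
    have h1 := sum_tauSum_mul_tauSum (PowerSeries.X : ℚ⟦X⟧) V
    have h2 : ∑ U ∈ (lits V).powerset with (Consistent U ∧ vars U = V),
        sigma (PowerSeries.X : ℚ⟦X⟧) U = ∑ K ∈ V.powerset,
          (2 ^ K.card * egfCoeff rootSeries K.card) *
            (2 ^ (V \ K).card * egfCoeff rootSeries (V \ K).card) := by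
      rw [Finset.sum_congr rfl (g := fun _ => egfCoeff hadamardInverse V.card) fun U hU => ?_,
        Finset.sum_const, card_consistent_vars_eq, nsmul_eq_mul]
      · have h3 := sum_egfCoeff_mul rootSeries rootSeries V
        rw [← pow_two, squareRoot_sq _ constantCoeff_hadamard_graphGF_inverse] at h3
        rw [← h3, Finset.mul_sum]
        refine Finset.sum_congr rfl fun K hK => ?_
        rw [← card_add_card_sdiff (Finset.mem_powerset.1 hK), pow_add]
        push_cast
        ring
      · rw [Finset.mem_filter] at hU
        rw [sigma_eq, ← hU.2.1.card_vars, hU.2.2]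
    -- By induction the two squares differ only in the terms K = ∅ and K = V, which leaves twice the
    -- wanted difference.
    rw [h2, ← sub_eq_zero, ← Finset.sum_sub_distrib, ← Finset.sum_subset (s₁ := {∅, V}),
      Finset.sum_pair hV.ne_empty.symm] at h1
    · have h0 := constantCoeff_squareRoot _ constantCoeff_hadamard_graphGF_inverse
      rw [← egfCoeff_zero] at h0
      simp only [tauSum_empty, Finset.sdiff_self, Finset.sdiff_empty, Finset.card_empty, h0,
        pow_zero, one_mul, mul_one] at h1
      rw [← two_mul, mul_eq_zero] at h1
      refine sub_eq_zero.1 (h1.resolve_left fun h => ?_)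
      have := congrArg PowerSeries.constantCoeff h
      rw [map_ofNat, map_zero] at this
      exact two_ne_zero this
    · intro K hK
      rw [Finset.mem_insert, Finset.mem_singleton] at hK
      rcases hK with rfl | rfl <;> simp
    · intro K hK hne
      rw [Finset.mem_insert, Finset.mem_singleton, not_or] at hne
      rw [Finset.mem_powerset] at hK
      rw [ih K (hK.ssubset_of_ne hne.2), ih (V \ K), sub_self]
      exact Finset.sdiff_ssubset hK (Finset.nonempty_iff_ne_empty.2 hne.1)

/-- The series `∑ 2ⁿ sₙ (1 + w)^(-n(n-1)) zⁿ / n!`, where `sₙ` are the coefficients of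
`rootSeries`. -/
def graphicRoot : BiSeries :=
  egf fun n => 2 ^ n * egfCoeff rootSeries n *
    ((onePlusW ^ (-(2 * n.choose 2 : ℤ)) : (ℚ⟦X⟧)ˣ) : ℚ⟦X⟧)

theorem onePlusW_pow_mul (k : ℕ) (a : ℤ) :
    (1 + PowerSeries.X : ℚ⟦X⟧) ^ k * ((onePlusW ^ a : (ℚ⟦X⟧)ˣ) : ℚ⟦X⟧) =
      ((onePlusW ^ (k + a) : (ℚ⟦X⟧)ˣ) : ℚ⟦X⟧) := by
  rw [zpow_add, zpow_natCast, Units.val_mul, Units.val_pow_eq_pow_val]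
  rfl

/-- With j + k = n, the exponent (j choose 2) + 2jk equals 2(n choose 2) - (j choose 2) - 2(k choose
2). The recursion thus becomes multiplication by 1/G at 2z, which G at 2z undoes. -/
theorem satSum_eq (V : Finset (Fin n)) :
    satSum (PowerSeries.X : ℚ⟦X⟧) V = (1 + PowerSeries.X) ^ (2 * V.card.choose 2) *
      egfCoeff (PowerSeries.rescale 2 graphGF * graphicRoot) V.card := by
  classical
  induction V using Finset.strongInduction with
  | H V ih =>
    have h1 := tauSum_eq_sum (PowerSeries.X : ℚ⟦X⟧) V
    rw [Finset.sum_congr rfl (g := fun U => (fun J : Finset (Fin n) =>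
      egfCoeff hadamardInverse J.card * (1 + PowerSeries.X) ^
        (J.card.choose 2 + J.card * ((V \ J).card * 2)) * satSum PowerSeries.X (V \ J)) (vars U)) ?_,
      sum_consistent V (fun J : Finset (Fin n) => egfCoeff hadamardInverse J.card *
        (1 + PowerSeries.X) ^ (J.card.choose 2 + J.card * ((V \ J).card * 2)) *
          satSum (PowerSeries.X : ℚ⟦X⟧) (V \ J)), tauSum_eq] at h1
    swap
    · intro U hU
      rw [Finset.mem_filter] at hU
      simp only [sigma_eq, hU.2.card_vars]
    have h2 : 2 ^ V.card * egfCoeff rootSeries V.card = ∑ J ∈ V.powerset, 2 ^ J.card *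
        (egfCoeff hadamardInverse J.card *
        (1 + PowerSeries.X) ^ (J.card.choose 2 + J.card * ((V \ J).card * 2)) *
          ((1 + PowerSeries.X) ^ (2 * (V \ J).card.choose 2) *
            egfCoeff (PowerSeries.rescale 2 graphGF * graphicRoot) (V \ J).card)) := by
      have h3 := sum_egfCoeff_mul (PowerSeries.rescale 2 (inverse graphGF))
        (PowerSeries.rescale 2 graphGF * graphicRoot) V
      rw [← mul_assoc, ← map_mul, mul_comm (inverse graphGF),
        mul_inverse _ constantCoeff_graphGF, map_one, one_mul] at h3
      have h4 : 2 ^ V.card * egfCoeff rootSeries V.card =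
          (1 + PowerSeries.X) ^ (2 * V.card.choose 2) * egfCoeff graphicRoot V.card := by
        rw [graphicRoot, egfCoeff_egf, mul_left_comm, onePlusW_pow_mul]
        simp
      rw [h4, ← h3, Finset.mul_sum]
      refine Finset.sum_congr rfl fun J hJ => ?_
      rw [egfCoeff_rescale, egfCoeff_hadamardInverse,
        ← card_add_card_sdiff (Finset.mem_powerset.1 hJ), choose_two_add]
      ring
    -- For nonempty J the terms agree by induction, so only J = ∅, the full set of variables,
    -- remains.
    rw [h2, eq_comm, ← sub_eq_zero, ← Finset.sum_sub_distrib,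
      Finset.sum_eq_single_of_mem ∅ (Finset.empty_mem_powerset V)] at h1
    · have h0 : egfCoeff hadamardInverse 0 = 1 := by
        rw [egfCoeff_zero, constantCoeff_hadamard_graphGF_inverse]
      simpa [h0, sub_eq_zero] using h1
    · intro J hJ hne
      rw [ih (V \ J), sub_self]
      exact Finset.sdiff_ssubset (Finset.mem_powerset.1 hJ) (Finset.nonempty_iff_ne_empty.2 hne)

theorem satSum_univ (n : ℕ) :
    satSum (PowerSeries.X : ℚ⟦X⟧) (Finset.univ : Finset (Fin n)) =
      2 ^ n * egfCoeff (PowerSeries.rescale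
        ((onePlusW ^ (2 * ((n : ℤ) - 1)) : (ℚ⟦X⟧)ˣ) : ℚ⟦X⟧) graphicSet * rootSeries) n := by
  rw [satSum_eq, Finset.card_univ, Fintype.card_fin, egfCoeff_mul, egfCoeff_mul, Finset.mul_sum,
    Finset.mul_sum]
  refine Finset.sum_congr rfl fun k hk => ?_
  obtain ⟨l, rfl⟩ := Nat.exists_eq_add_of_le (Nat.lt_succ_iff.1 (Finset.mem_range.1 hk))
  rw [Nat.add_sub_cancel_left, mul_smul_comm, mul_smul_comm, egfCoeff_rescale, egfCoeff_rescale,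
    egfCoeff_graphGF, graphicRoot, graphicSet, egfCoeff_egf, egfCoeff_egf,
    ← Units.val_pow_eq_pow_val, ← zpow_natCast, ← zpow_mul, ← Units.val_mul, ← zpow_add]
  congr 1
  -- This exponent identity absorbs the prefactor (1+w)^(n(n-1)): it turns the coefficients of G
  -- into those of the graphic set series rescaled by (1+w)^(2(n-1)).
  have h1 : (2 * ((k + l : ℕ) - 1) * k + -(k.choose 2) : ℤ) =
      ((2 * (k + l).choose 2 + k.choose 2 : ℕ) : ℤ) + -(2 * l.choose 2) := by
    have h2 : ((k * k : ℕ) : ℤ) = ((2 * k.choose 2 + k : ℕ) : ℤ) := by rw [mul_self_eq]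
    rw [choose_two_add]
    push_cast at h2 ⊢
    linear_combination 2 * h2
  rw [h1, ← onePlusW_pow_mul, pow_add, pow_add]
  ring

theorem isTwoCNF_iff {F : Formula n} : F.IsTwoCNF ↔ F ⊆ clauses Finset.univ := by
  have h : ∀ c : Clause n, c ⊆ lits Finset.univ := fun c l _ => by simp
  simp only [Formula.IsTwoCNF, Formula.IsCNF, Finset.subset_iff (s₁ := F), clauses,
    Finset.mem_filter, Finset.mem_powersetCard, h, true_and]
  exact ⟨fun h c hc => ⟨h.2 c hc, h.1 c hc⟩, fun h => ⟨fun c hc => (h hc).2, fun c hc => (h hc).1⟩⟩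

theorem coeff_satSum (n m : ℕ) :
    PowerSeries.coeff m (satSum (PowerSeries.X : ℚ⟦X⟧) (Finset.univ : Finset (Fin n))) =
      satCount n m := by
  classical
  rw [satSum, wsum, map_sum, satCount, Nat.card_eq_fintype_card, Fintype.card_subtype,
    Finset.card_filter, Nat.cast_sum, ← Finset.sum_subset (Finset.subset_univ
      (clauses (Finset.univ : Finset (Fin n))).powerset)]
  · refine Finset.sum_congr rfl fun F hF => ?_
    rw [Finset.mem_powerset, ← isTwoCNF_iff] at hF
    rw [mul_ite, mul_one, mul_zero]
    by_cases hs : Formula.Satisfiable F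
    · simp [hs, hF, PowerSeries.coeff_X_pow, eq_comm]
    · simp [hs]
  · intro F _ hF
    rw [Finset.mem_powerset, ← isTwoCNF_iff] at hF
    simp [hF]

end Solution

end TwoSat

end

theorem mainTheorem3 (n m : ℕ) :
    (TwoSat.satCount n m : ℚ) =
      2 ^ n * (n ! : ℚ) *
        PowerSeries.coeff m (PowerSeries.coeff n
          (PowerSeries.rescale
              ((TwoSat.onePlusW ^ (2 * ((n : ℤ) - 1)) : (ℚ⟦X⟧)ˣ) : ℚ⟦X⟧) TwoSat.graphicSet *
            TwoSat.squareRoot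
              (TwoSat.hadamard TwoSat.graphGF (TwoSat.inverse TwoSat.graphGF)))) := by
  rw [← TwoSat.coeff_satSum, TwoSat.satSum_univ, TwoSat.egfCoeff, mul_smul_comm, mul_assoc]
  have h : (2 : ℚ⟦X⟧) ^ n = PowerSeries.C (2 ^ n : ℚ) := by rw [map_pow, map_ofNat]
  rw [h, map_smul, PowerSeries.coeff_C_mul, smul_eq_mul]
  ring
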